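/- Let $V:(-1,1)\to\mathbb R$ be measurable with $V(x)\ge 0$ and $(1-x^2)V(x)\le M<\infty$ for a.e. $x\in(-1,1)$. For $u$ with $\int_{-1}^1|u|^2\frac{dx}{1-x^2}<\infty$ put $$U(\xi)=\mathcal P[u](\xi)=\int_{-1}^1u(y)\Bigl(\frac{1-y}{1+y}\Bigr)^{i\xi}\frac{dy}{1-y^2},\qquad \xi\in\mathbb R$$ (understood, as for the Fourier transform, as an $L_2$-extension from absolutely integrable $u$), and for $s\ge0$ let $\widetilde H^s$ be the space of all such complex-valued $u$ with $$\|u\|_{\widetilde H^s}^2=\frac1\pi\int_{-\infty}^\infty(1+4\xi^2)^s|U(\xi)|^2\,d\xi<\infty .$$ Let $(\widetilde H^s)^*$ be the dual of $\widetilde H^s$ with respect to the pairing in $L_2(-1,1)$, i.e. the space of continuous antilinear functionals $g\mapsto(f,g)$ on $\widetilde H^s$, with norm $\sup_{0\ne g\in\widetilde H^s}|(f,g)|/\|g\|_{\widetilde H^s}$; for $s\le t$ one has $(\widetilde H^s)^*\subset(\widetilde H^t)^*$ by restriction. For $f\in(\widetilde H^{1/2})^*$ a weak solution of the Prandtl problem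 $$V(x)u(x)-\frac1{2\pi}\int_{-1}^1\frac{u'(t)}{t-x}\,dt=f(x),\qquad u(-1)=u(1)=0,$$ is an element $u\in\widetilde H^{1/2}$ such that for all $g\in\widetilde H^{1/2}$, with $G=\mathcal P[g]$, $$\int_{-1}^1V(x)u(x)\overline{g(x)}\,dx+\frac1\pi\int_{-\infty}^\infty\xi\coth(\pi\xi)\,U(\xi)\overline{G(\xi)}\,d\xi=(f,g).$$ Let $0<\theta\le\frac12$ and $f\in(\widetilde H^{1/2-\theta})^*$. Then the problem has a unique weak solution $u\in\widetilde H^{1/2}$; it is (after modification on a null set) continuous on the closed interval $[-1,1]$, satisfies $u(-1)=u(1)=0$, and $$\|u\|_{C[-1,1]}\le C\bigl(\tfrac12+\theta\bigr)\,C_\theta\,\|f\|_{(\widetilde H^{1/2-\theta})^*},$$ where $$C(s)=\Bigl(\frac{\Gamma(s-1/2)}{2\sqrt\pi\,\Gamma(s)}\Bigr)^{1/2},\qquad C_\theta=\pi^{1-2\theta}C_2^{\theta},\qquad C_2=\pi^2\Bigl(2+\frac\pi2M\Bigr).$$ -/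

import Mathlib

open MeasureTheory Set Filter Topology
open scoped FourierTransform ENNReal ComplexConjugate

noncomputable section

namespace Prandtl

/-- The measure `dx / (1 - x²)` on the interval `(-1, 1)`. -/
def hypMeasure : Measure ℝ :=
  (volume.restrict (Ioo (-1 : ℝ) 1)).withDensity (fun x => ENNReal.ofReal (1 / (1 - x ^ 2)))

/-- The space of measurable functions on `(-1, 1)` with `∫ |u|² / (1 - x²) dx < ∞`
(modulo equality almost everywhere). -/
abbrev L2Tilde : Type := Lp ℂ 2 hypMeasure

theorem hasDerivAt_tanh (x : ℝ) : HasDerivAt Real.tanh (1 / Real.cosh x ^ 2) x := by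
  have h := (Real.hasDerivAt_sinh x).div (Real.hasDerivAt_cosh x) (Real.cosh_pos x).ne'
  have e : Real.tanh = Real.sinh / Real.cosh := by
    funext y; simp [Real.tanh_eq_sinh_div_cosh]
  rw [e]
  have h2 : 1 / Real.cosh x ^ 2 =
      (Real.cosh x * Real.cosh x - Real.sinh x * Real.sinh x) / Real.cosh x ^ 2 := by
    rw [← pow_two, ← pow_two, Real.cosh_sq]
    ring
  rw [h2]
  exact h

theorem range_tanh : range Real.tanh = Ioo (-1 : ℝ) 1 := by
  ext x
  constructor
  · rintro ⟨y, rfl⟩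
    exact ⟨Real.neg_one_lt_tanh y, Real.tanh_lt_one y⟩
  · intro hx
    exact ⟨Real.artanh x, Real.tanh_artanh hx⟩

/-- The substitution `x = tanh ω` takes `dω` to `dx / (1 - x²)`. -/
theorem measurePreserving_tanh : MeasurePreserving Real.tanh volume hypMeasure := by
  have hc : Continuous Real.tanh :=
    continuous_iff_continuousAt.2 fun x => (hasDerivAt_tanh x).continuousAt
  refine ⟨hc.measurable, ?_⟩
  ext A hA
  have hinj : InjOn Real.tanh univ := Real.tanh_injective.injOn
  rw [Measure.map_apply hc.measurable hA, hypMeasure, withDensity_apply _ hA,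
    ← lintegral_indicator hA, ← range_tanh, ← image_univ,
    lintegral_image_eq_lintegral_abs_deriv_mul MeasurableSet.univ
      (fun x _ => (hasDerivAt_tanh x).hasDerivWithinAt) hinj, setLIntegral_univ,
    ← lintegral_indicator_one (hc.measurable hA)]
  refine lintegral_congr fun x => ?_
  by_cases hx : Real.tanh x ∈ A
  · have hp := Real.cosh_pos x
    have h1 : 1 - Real.tanh x ^ 2 = 1 / Real.cosh x ^ 2 := by
      rw [Real.tanh_eq_sinh_div_cosh]
      field_simp
      nlinarith [Real.cosh_sq x]
    rw [indicator_of_mem (by exact hx), indicator_of_mem hx, h1,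
      ← ENNReal.ofReal_mul (abs_nonneg _), abs_of_pos (by positivity)]
    have : 1 / Real.cosh x ^ 2 * (1 / (1 / Real.cosh x ^ 2)) = 1 := by field_simp
    rw [this]; simp
  · rw [indicator_of_notMem (by exact hx), indicator_of_notMem hx, mul_zero]

/-- The isometry `u ↦ u₁`, `u₁(ω) = u(tanh ω)`. -/
def compTanh : L2Tilde →ₗᵢ[ℂ] Lp ℂ 2 (volume : Measure ℝ) :=
  Lp.compMeasurePreservingₗᵢ ℂ Real.tanh measurePreserving_tanh

/-- The transform `P[u](ξ) = ∫_{-1}^{1} u(y) ((1 - y) / (1 + y)) ^ (i ξ) dy / (1 - y²)` on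
`L2Tilde`. As the integral need not converge absolutely, it is read (as for the Fourier
transform) as an `L²`-extension: with `y = tanh ω` the kernel is `exp (-2 i ξ ω)` and the integral
is `∫ u(tanh ω) exp (-2 i ξ ω) dω`, the `L²`-Fourier transform of `u ∘ tanh` at the frequency
`ξ / π` in Mathlib's normalisation `exp (-2 π i ω ζ)`. The integral formula itself is
`pTransform_ae_eq_integral`. -/
def pTransform (u : L2Tilde) : ℝ → ℂ :=
  fun ξ => (𝓕 (compTanh u) : Lp ℂ 2 (volume : Measure ℝ)) (ξ / Real.pi)

theorem quasi_div_pi :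
    Measure.QuasiMeasurePreserving (fun ξ : ℝ => ξ / Real.pi) volume volume := by
  refine ⟨by fun_prop, ?_⟩
  have : (fun ξ : ℝ => ξ / Real.pi) = fun ξ => ξ * Real.pi⁻¹ := by
    funext ξ; rw [div_eq_mul_inv]
  rw [this, Real.map_volume_mul_right (inv_ne_zero Real.pi_ne_zero)]
  exact Measure.smul_absolutelyContinuous

theorem pTransform_add (u v : L2Tilde) :
    pTransform (u + v) =ᵐ[volume] pTransform u + pTransform v := by
  have h : (𝓕 (compTanh (u + v)) : Lp ℂ 2 (volume : Measure ℝ))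
      = 𝓕 (compTanh u) + 𝓕 (compTanh v) := by
    rw [map_add, FourierTransform.fourier_add]
  have h2 := quasi_div_pi.ae (Lp.coeFn_add (𝓕 (compTanh u)) (𝓕 (compTanh v)))
  filter_upwards [h2] with ξ hξ
  simp only [pTransform, Pi.add_apply, h]
  exact hξ

theorem pTransform_smul (c : ℂ) (u : L2Tilde) :
    pTransform (c • u) =ᵐ[volume] c • pTransform u := by
  have h : (𝓕 (compTanh (c • u)) : Lp ℂ 2 (volume : Measure ℝ)) = c • 𝓕 (compTanh u) := by
    rw [map_smul, FourierTransform.fourier_smul]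
  have h2 := quasi_div_pi.ae (Lp.coeFn_smul c (𝓕 (compTanh u)))
  filter_upwards [h2] with ξ hξ
  simp only [pTransform, Pi.smul_apply, h]
  exact hξ

theorem aestronglyMeasurable_pTransform (u : L2Tilde) :
    AEStronglyMeasurable (pTransform u) volume :=
  (Lp.aestronglyMeasurable (𝓕 (compTanh u))).comp_quasiMeasurePreserving quasi_div_pi

/-- On integrable functions the `L²`-Fourier transform is given by the Fourier integral. -/
theorem fourier_Lp_ae_eq (g : Lp ℂ 2 (volume : Measure ℝ)) (hg : Integrable g volume) :
    (𝓕 g : Lp ℂ 2 (volume : Measure ℝ)) =ᵐ[volume] 𝓕 (g : ℝ → ℂ) := by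
  have hcont : Continuous (𝓕 (g : ℝ → ℂ)) :=
    VectorFourier.fourierIntegral_continuous Real.continuous_fourierChar
      (by exact continuous_inner) hg
  refine ae_eq_of_integral_contDiff_smul_eq
    ((Lp.memLp (𝓕 g : Lp ℂ 2 (volume : Measure ℝ))).locallyIntegrable (by norm_num))
    hcont.locallyIntegrable fun φ hφ hφc => ?_
  have hψ : ContDiff ℝ (⊤ : ℕ∞) (fun x => (φ x : ℂ)) := Complex.ofRealCLM.contDiff.comp hφ
  have hψc : HasCompactSupport (fun x => (φ x : ℂ)) :=
    hφc.comp_left (g := fun x : ℝ => (x : ℂ)) Complex.ofReal_zero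
  set ψ : SchwartzMap ℝ ℂ := hψc.toSchwartzMap hψ with hψdef
  have hψa : ∀ x, ψ x = (φ x : ℂ) := fun x => rfl
  have h1 : (∫ x, ψ x • (𝓕 g : Lp ℂ 2 (volume : Measure ℝ)) x) = ∫ x, (𝓕 ψ) x • g x := by
    rw [← Lp.toTemperedDistribution_apply, ← Lp.fourier_toTemperedDistribution_eq,
      TemperedDistribution.fourier_apply, Lp.toTemperedDistribution_apply]
  have h2 : (∫ x, (𝓕 (ψ : ℝ → ℂ)) x • g x) = ∫ x, ψ x • 𝓕 (g : ℝ → ℂ) x := by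
    have h := VectorFourier.integral_fourierIntegral_smul_eq_flip (L := innerₗ ℝ)
      (μ := (volume : Measure ℝ)) (ν := (volume : Measure ℝ)) (f := ψ) (g := (g : ℝ → ℂ))
      Real.continuous_fourierChar (by exact continuous_inner) ψ.integrable hg
    rwa [flip_innerₗ] at h
  rw [← SchwartzMap.fourier_coe] at h2
  have h3 := h1.trans h2
  simpa [hψa] using h3

/-- The kernel `((1 - y) / (1 + y)) ^ (i ξ)`. -/
def pKernel (ξ y : ℝ) : ℂ := (((1 - y) / (1 + y) : ℝ) : ℂ) ^ (Complex.I * ξ)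

theorem pKernel_tanh (ξ ω : ℝ) :
    pKernel ξ (Real.tanh ω) = Complex.exp (-2 * Complex.I * ξ * ω) := by
  have h : (1 - Real.tanh ω) / (1 + Real.tanh ω) = Real.exp (-2 * ω) := by
    have hp := Real.cosh_pos ω
    have h1 : 1 + Real.tanh ω ≠ 0 := by linarith [Real.neg_one_lt_tanh ω]
    have h2 : Real.exp (-2 * ω) = Real.exp (-ω) / Real.exp ω := by
      rw [← Real.exp_sub]; ring_nf
    rw [div_eq_iff h1, h2, Real.tanh_eq_sinh_div_cosh, ← Real.cosh_sub_sinh,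
      ← Real.cosh_add_sinh]
    have h3 : Real.cosh ω + Real.sinh ω ≠ 0 := by
      rw [Real.cosh_add_sinh]; exact (Real.exp_pos ω).ne'
    field_simp
  rw [pKernel, h, Complex.cpow_def_of_ne_zero (by exact_mod_cast (Real.exp_pos _).ne'),
    ← Complex.ofReal_log (Real.exp_pos _).le, Real.log_exp]
  congr 1
  push_cast
  ring

/-- The integral formula for `pTransform`, valid whenever the integral converges absolutely. -/
theorem pTransform_ae_eq_integral (u : L2Tilde) (hu : Integrable u hypMeasure) :
    pTransform u =ᵐ[volume]
      fun ξ => ∫ y in Ioo (-1 : ℝ) 1, u y * pKernel ξ y * ((1 / (1 - y ^ 2) : ℝ) : ℂ) := by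
  have hcomp : (compTanh u : ℝ → ℂ) =ᵐ[volume] u ∘ Real.tanh :=
    Lp.coeFn_compMeasurePreserving u measurePreserving_tanh
  have hint : Integrable (compTanh u : ℝ → ℂ) volume :=
    (integrable_congr hcomp).2 (measurePreserving_tanh.integrable_comp_of_integrable hu)
  filter_upwards [quasi_div_pi.ae (fourier_Lp_ae_eq (compTanh u) hint)] with ξ hξ
  rw [pTransform, hξ, Real.fourier_eq', ← range_tanh, ← image_univ,
    integral_image_eq_integral_abs_deriv_smul MeasurableSet.univ
      (fun x _ => (hasDerivAt_tanh x).hasDerivWithinAt) Real.tanh_injective.injOn,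
    setIntegral_univ]
  refine integral_congr_ae ?_
  filter_upwards [hcomp] with ω hω
  rw [hω, pKernel_tanh]
  have hp := Real.cosh_pos ω
  have h1 : 1 - Real.tanh ω ^ 2 = 1 / Real.cosh ω ^ 2 := by
    rw [Real.tanh_eq_sinh_div_cosh]
    field_simp
    nlinarith [Real.cosh_sq ω]
  rw [h1, abs_of_pos (by positivity), Function.comp_apply, smul_eq_mul, Complex.real_smul]
  have h2 : ((1 / Real.cosh ω ^ 2 : ℝ) : ℂ) * ((1 / (1 / Real.cosh ω ^ 2) : ℝ) : ℂ) = 1 := by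
    rw [← Complex.ofReal_mul, ← Complex.ofReal_one]
    congr 1
    field_simp
  have h3 : Complex.exp (((-2 * Real.pi * inner ℝ ω (ξ / Real.pi) : ℝ) : ℂ) * Complex.I)
      = Complex.exp (-2 * Complex.I * ξ * ω) := by
    congr 1
    have : (Real.pi : ℂ) ≠ 0 := by exact_mod_cast Real.pi_ne_zero
    simp
    field_simp
  rw [h3]
  linear_combination (-(Complex.exp (-2 * Complex.I * ξ * ω) * u (Real.tanh ω))) * h2

/-- The measure `π⁻¹ (1 + 4 ξ²) ^ s dξ` on the line. -/
def sobolevMeasure (s : ℝ) : Measure ℝ :=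
  volume.withDensity (fun ξ => ENNReal.ofReal ((1 + 4 * ξ ^ 2) ^ s / Real.pi))

theorem sobolevMeasure_ac (s : ℝ) : sobolevMeasure s ≪ volume :=
  withDensity_absolutelyContinuous _ _

theorem ac_sobolevMeasure (s : ℝ) : volume ≪ sobolevMeasure s := by
  refine withDensity_absolutelyContinuous' ?_ ?_
  · exact Measurable.aemeasurable (by fun_prop)
  · refine Eventually.of_forall fun ξ => ?_
    rw [ne_eq, ENNReal.ofReal_eq_zero, not_le]
    have := Real.pi_pos
    positivity

/-- The space `H̃ˢ(-1, 1)`, as a subspace of `L2Tilde`: all `u` such that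
`π⁻¹ ∫ (1 + 4 ξ²) ^ s |P[u](ξ)|² dξ < ∞`. -/
def hTildeSubmodule (s : ℝ) : Submodule ℂ L2Tilde where
  carrier := {u | MemLp (pTransform u) 2 (sobolevMeasure s)}
  zero_mem' := by
    have h := (sobolevMeasure_ac s).ae_eq (pTransform_smul 0 0)
    rw [zero_smul, zero_smul] at h
    exact (memLp_congr_ae h).2 MemLp.zero
  add_mem' := fun {u v} hu hv =>
    (memLp_congr_ae ((sobolevMeasure_ac s).ae_eq (pTransform_add u v))).2 (hu.add hv)
  smul_mem' := fun c u hu =>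
    (memLp_congr_ae ((sobolevMeasure_ac s).ae_eq (pTransform_smul c u))).2 (hu.const_smul c)

/-- The space `H̃ˢ(-1, 1)` (used for `s ≥ 0`). It is a type of its own, because its norm is not
the one inherited from `L2Tilde`. -/
def HTilde (s : ℝ) : Type := hTildeSubmodule s

namespace HTilde

variable {s t : ℝ}

instance : AddCommGroup (HTilde s) := inferInstanceAs (AddCommGroup (hTildeSubmodule s))

instance : Module ℂ (HTilde s) := inferInstanceAs (Module ℂ (hTildeSubmodule s))

/-- An element of `H̃ˢ` as an element of `L2Tilde`. -/
def toL2 : HTilde s →ₗ[ℂ] L2Tilde := (hTildeSubmodule s).subtype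

theorem toL2_injective : Function.Injective (toL2 (s := s)) := Subtype.val_injective

/-- The function on `(-1, 1)` (almost everywhere defined) given by an element of `H̃ˢ`. -/
def fn (u : HTilde s) : ℝ → ℂ := toL2 u

/-- The transform `U = P[u]` of an element of `H̃ˢ`. -/
def transform (u : HTilde s) : ℝ → ℂ := pTransform (toL2 u)

theorem memLp_transform (u : HTilde s) : MemLp (transform u) 2 (sobolevMeasure s) := u.2

theorem sobolevMeasure_mono (hst : s ≤ t) : sobolevMeasure s ≤ sobolevMeasure t := by
  refine withDensity_mono (Eventually.of_forall fun ξ => ENNReal.ofReal_le_ofReal ?_)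
  have : (1 : ℝ) ≤ 1 + 4 * ξ ^ 2 := by nlinarith [sq_nonneg ξ]
  exact div_le_div_of_nonneg_right (Real.rpow_le_rpow_of_exponent_le this hst) Real.pi_pos.le

/-- An element of `L2Tilde` whose transform satisfies the condition, as an element of `H̃ˢ`. -/
def ofL2 (x : L2Tilde) (hx : MemLp (pTransform x) 2 (sobolevMeasure s)) : HTilde s := ⟨x, hx⟩

theorem toL2_ofL2 (x : L2Tilde) (hx : MemLp (pTransform x) 2 (sobolevMeasure s)) :
    toL2 (ofL2 x hx) = x := (rfl)

theorem memLp_of_le (hst : s ≤ t) (u : HTilde t) :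
    MemLp (pTransform (toL2 u)) 2 (sobolevMeasure s) :=
  MemLp.mono_measure (sobolevMeasure_mono hst) (memLp_transform u)

/-- The embedding of `H̃ᵗ` into `H̃ˢ` for `s ≤ t`, as a linear map. -/
def inclusionₗ (hst : s ≤ t) : HTilde t →ₗ[ℂ] HTilde s where
  toFun u := ofL2 (toL2 u) (memLp_of_le hst u)
  map_add' u v := toL2_injective (by simp only [map_add, toL2_ofL2])
  map_smul' c u := toL2_injective (by simp only [map_smul, toL2_ofL2, RingHom.id_apply])

theorem toL2_inclusionₗ (hst : s ≤ t) (u : HTilde t) : toL2 (inclusionₗ hst u) = toL2 u :=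
  toL2_ofL2 (toL2 u) (memLp_of_le hst u)

/-- `u ↦ P[u]` as a linear map to the weighted `L²` space that defines the norm. -/
def transformLp : HTilde s →ₗ[ℂ] Lp ℂ 2 (sobolevMeasure s) where
  toFun u := (memLp_transform u).toLp _
  map_add' u v := by
    rw [← MemLp.toLp_add, MemLp.toLp_eq_toLp_iff]
    exact (sobolevMeasure_ac s).ae_eq (by
      simpa [transform, map_add] using pTransform_add (toL2 u) (toL2 v))
  map_smul' c u := by
    rw [RingHom.id_apply, ← MemLp.toLp_const_smul, MemLp.toLp_eq_toLp_iff]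
    exact (sobolevMeasure_ac s).ae_eq (by
      simpa [transform, map_smul] using pTransform_smul c (toL2 u))

theorem transformLp_injective : Function.Injective (transformLp (s := s)) := by
  rw [← LinearMap.ker_eq_bot, LinearMap.ker_eq_bot']
  intro u hu
  have h0 : transform u =ᵐ[volume] 0 := by
    have : (memLp_transform u).toLp _ = 0 := hu
    exact (ac_sobolevMeasure s).ae_eq
      ((MemLp.coeFn_toLp (memLp_transform u)).symm.trans (this ▸ Lp.coeFn_zero _ _ _))
  have h1 : (𝓕 (compTanh (toL2 u)) : Lp ℂ 2 (volume : Measure ℝ)) = 0 := by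
    have hq : Measure.QuasiMeasurePreserving (fun ξ : ℝ => ξ * Real.pi) volume volume := by
      refine ⟨by fun_prop, ?_⟩
      rw [Real.map_volume_mul_right Real.pi_ne_zero]
      exact Measure.smul_absolutelyContinuous
    rw [Lp.eq_zero_iff_ae_eq_zero]
    filter_upwards [hq.ae h0] with ξ hξ
    simpa [transform, pTransform, Real.pi_ne_zero] using hξ
  have h2 : compTanh (toL2 u) = 0 := by
    rw [← norm_eq_zero, ← Lp.norm_fourier_eq, h1, norm_zero]
  apply toL2_injective
  rw [map_zero]
  rw [← norm_eq_zero, ← compTanh.norm_map, h2, norm_zero]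

/-- The norm of `H̃ˢ`: the norm of `P[u]` in `L²(π⁻¹ (1 + 4 ξ²) ^ s dξ)`. -/
instance : NormedAddCommGroup (HTilde s) :=
  NormedAddCommGroup.induced (HTilde s) (Lp ℂ 2 (sobolevMeasure s)) transformLp
    transformLp_injective

instance : NormedSpace ℂ (HTilde s) :=
  NormedSpace.induced ℂ (HTilde s) (Lp ℂ 2 (sobolevMeasure s)) transformLp

theorem norm_eq (u : HTilde s) : ‖u‖ = ‖transformLp u‖ := rfl

/-- The norm of `H̃ˢ` is given by `‖u‖² = π⁻¹ ∫ (1 + 4 ξ²) ^ s |P[u](ξ)|² dξ`. -/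
theorem norm_sq_eq (u : HTilde s) :
    ‖u‖ ^ 2 = 1 / Real.pi * ∫ ξ, (1 + 4 * ξ ^ 2) ^ s * ‖transform u ξ‖ ^ 2 := by
  have h1 : ‖u‖ ^ 2 = ∫ ξ, ‖transform u ξ‖ ^ 2 ∂(sobolevMeasure s) := by
    have h := L2.integral_inner_eq_sq_eLpNorm (𝕜 := ℂ) (transformLp u)
    have h' := inner_self_eq_norm_sq (𝕜 := ℂ) (transformLp u)
    rw [norm_eq, ← h', L2.inner_def]
    rw [← integral_re (L2.integrable_inner _ _)]
    refine integral_congr_ae ?_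
    filter_upwards [MemLp.coeFn_toLp (memLp_transform u)] with ξ hξ
    have : (transformLp u : ℝ → ℂ) ξ = transform u ξ := hξ
    rw [this, inner_self_eq_norm_sq]
  have hpos : ∀ ξ : ℝ, 0 ≤ (1 + 4 * ξ ^ 2) ^ s / Real.pi := fun ξ => by
    have := Real.pi_pos
    positivity
  rw [h1, sobolevMeasure, integral_withDensity_eq_integral_toReal_smul (by fun_prop)
    (Eventually.of_forall fun ξ => ENNReal.ofReal_lt_top), ← integral_const_mul]
  refine integral_congr_ae (Eventually.of_forall fun ξ => ?_)
  simp only [ENNReal.toReal_ofReal (hpos ξ), smul_eq_mul]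
  ring

theorem norm_eq_eLpNorm (u : HTilde s) :
    ‖u‖ = (eLpNorm (transform u) 2 (sobolevMeasure s)).toReal :=
  Lp.norm_toLp (transform u) (memLp_transform u)

theorem norm_inclusionₗ_le (hst : s ≤ t) (u : HTilde t) : ‖inclusionₗ hst u‖ ≤ 1 * ‖u‖ := by
  rw [one_mul, norm_eq_eLpNorm, norm_eq_eLpNorm, transform, toL2_inclusionₗ]
  exact ENNReal.toReal_mono (memLp_transform u).2.ne
    (eLpNorm_mono_measure _ (sobolevMeasure_mono hst))

/-- The continuous embedding of `H̃ᵗ` into `H̃ˢ` for `s ≤ t`. -/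
def inclusion (hst : s ≤ t) : HTilde t →L[ℂ] HTilde s :=
  (inclusionₗ hst).mkContinuous 1 (norm_inclusionₗ_le hst)

theorem toL2_inclusion (hst : s ≤ t) (u : HTilde t) : toL2 (inclusion hst u) = toL2 u :=
  toL2_inclusionₗ hst u

end HTilde

/-- The space `(H̃ˢ)*` dual to `H̃ˢ` with respect to the pairing in `L₂(-1, 1)`: the continuous
antilinear functionals `g ↦ (f, g)` on `H̃ˢ` (a function `f` acts by `g ↦ ∫ f \bar g dx`). The norm
is the operator norm, i.e. the supremum of `|(f, g)| / ‖g‖` over `g ≠ 0`. -/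
abbrev HTildeDual (s : ℝ) : Type := HTilde s →L⋆[ℂ] ℂ

/-- The embedding `(H̃ˢ)* ⊂ (H̃ᵗ)*` for `s ≤ t`, i.e. restriction of functionals to `H̃ᵗ ⊂ H̃ˢ`. -/
def HTildeDual.restrict {s t : ℝ} (hst : s ≤ t) (f : HTildeDual s) : HTildeDual t :=
  ContinuousLinearMap.comp f (HTilde.inclusion hst)

/-- The form
`[u, g]₁ = ∫_{-1}^{1} V u \bar g dx + π⁻¹ ∫ ξ coth(π ξ) U(ξ) \bar{G(ξ)} dξ`. -/
def form (V : ℝ → ℝ) (u g : HTilde (1 / 2)) : ℂ :=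
  (∫ x in Ioo (-1 : ℝ) 1, (V x : ℂ) * u.fn x * conj (g.fn x)) +
    1 / (Real.pi : ℂ) * ∫ ξ : ℝ,
      ((ξ * (Real.cosh (Real.pi * ξ) / Real.sinh (Real.pi * ξ)) : ℝ) : ℂ) *
        u.transform ξ * conj (g.transform ξ)

/-- `u ∈ H̃^{1/2}` is the weak solution of
`V(x) u(x) - (2π)⁻¹ p.v. ∫_{-1}^{1} u'(t) / (t - x) dt = f(x)`, `u(-1) = u(1) = 0`,
with `f ∈ (H̃^{1/2})*`. -/
def IsWeakSolution (V : ℝ → ℝ) (f : HTildeDual (1 / 2)) (u : HTilde (1 / 2)) : Prop :=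
  ∀ g : HTilde (1 / 2), form V u g = f g

/-- `C(s) = (Γ(s - 1/2) / (2 √π Γ(s))) ^ (1/2)`. -/
def embeddingConst (s : ℝ) : ℝ :=
  √(Real.Gamma (s - 1 / 2) / (2 * √Real.pi * Real.Gamma s))

/-- `C_θ = π ^ (1 - 2θ) C₂ ^ θ` with `C₂ = π² (2 + (π / 2) M)`. -/
def solutionConst (M θ : ℝ) : ℝ :=
  Real.pi ^ (1 - 2 * θ) * (Real.pi ^ 2 * (2 + Real.pi / 2 * M)) ^ θ

end Prandtl

end

noncomputable section

namespace Prandtl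

/-! The substitution `x = tanh ω` turns `P` into the Fourier transform (frequency `ζ = ξ / π`), so
the problem can be read in `L²` of the frequency line. With `m = ξ coth (π ξ)`, `D` the
multiplication by `m ^ (-1/2)` and `B` the Fourier conjugate of multiplication by `W = (1 - x²) V`,
`0 ≤ W ≤ M`, every element of `H̃^{1/2}` has transform `D x`, and the form becomes `⟨y, (1 + D B D)
x⟩` (`form_ofEnergy`). Since `D` is symmetric and `B ≥ 0`, this operator is coercive with constant
1, hence invertible with inverse `R`; this settles existence and uniqueness.

Let `w = 1 + 4 ξ²`. A functional on `H̃^{1/2-θ}` corresponds to some `φ ∈ L²` with `‖φ‖ ≤ ‖f‖`, and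
the solution has transform `D R D w^{(1-2θ)/4} φ`. Its norm in `H̃^{1/2+θ}` is at most `C_θ ‖φ‖` by
interpolation of `w^{(1+τ)/4} D R D w^{(1-τ)/4}` at `τ = 2θ` (`norm_truncPow_resolvent_le`). At `τ =
0` the bound `π` comes from `√w ≤ π m`. At `τ = 1` the equation `F = D² (φ - B F)` gives `‖w^{1/2}
F‖ ≤ π ‖φ - B F‖`, and `‖B F‖² ≤ M Re ⟨F, B F⟩ ≤ (π M / 4) ‖φ‖²` yields `√C₂`. The weight is first
truncated, so that all operators are bounded and entire in `τ`; monotone and dominated convergence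
remove the truncation.

As `1/2 + θ > 1/2`, Cauchy–Schwarz makes the transform integrable with constant `C(1/2 + θ)`, the
square root of `∫ w^{-s} dζ`, `s = 1/2 + θ`. Fourier inversion and the Riemann–Lebesgue lemma then
give continuity, and decay as `ω → ±∞`, that is, zero values at `x = ±1`. -/

/-- The space `L²(ℝ)`. -/
abbrev L2R : Type := Lp ℂ 2 (volume : Measure ℝ)

/-! ### Multiplication operators on `L²(ℝ)`. -/

/-- Bounded measurable multipliers. -/
def BddMul (a : ℝ → ℂ) : Prop := Measurable a ∧ ∃ C, ∀ x, ‖a x‖ ≤ C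

theorem BddMul.memLp {a : ℝ → ℂ} (h : BddMul a) (f : L2R) :
    MemLp (fun x => a x * f x) 2 volume := by
  obtain ⟨hm, C, hC⟩ := h
  refine (Lp.memLp f).of_le_mul (c := C)
    (hm.aestronglyMeasurable.mul (Lp.aestronglyMeasurable f)) (Eventually.of_forall fun x => ?_)
  rw [norm_mul]
  exact mul_le_mul_of_nonneg_right (hC x) (norm_nonneg _)

/-- Multiplication by `a` as a linear map on `L²(ℝ)`. -/
def mulLin (a : ℝ → ℂ) (h : BddMul a) : L2R →ₗ[ℂ] L2R where
  toFun f := (h.memLp f).toLp _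
  map_add' f g := by
    rw [← MemLp.toLp_add, MemLp.toLp_eq_toLp_iff]
    filter_upwards [Lp.coeFn_add f g] with x hx
    simp only [hx, Pi.add_apply, mul_add]
  map_smul' c f := by
    rw [RingHom.id_apply, ← MemLp.toLp_const_smul, MemLp.toLp_eq_toLp_iff]
    filter_upwards [Lp.coeFn_smul c f] with x hx
    simp only [hx, Pi.smul_apply, smul_eq_mul, mul_left_comm]

theorem coeFn_mulLin {a : ℝ → ℂ} (h : BddMul a) (f : L2R) :
    mulLin a h f =ᵐ[volume] fun x => a x * f x := MemLp.coeFn_toLp (h.memLp f)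

theorem norm_mulLin_le {a : ℝ → ℂ} (h : BddMul a) {C : ℝ} (hC : ∀ x, ‖a x‖ ≤ C) (f : L2R) :
    ‖mulLin a h f‖ ≤ C * ‖f‖ := by
  refine Lp.norm_le_mul_norm_of_ae_le_mul ?_
  filter_upwards [coeFn_mulLin h f] with x hx
  rw [hx, norm_mul]
  exact mul_le_mul_of_nonneg_right (hC x) (norm_nonneg _)

/-- Multiplication by `a` as a bounded operator on `L²(ℝ)`. -/
def mulOp (a : ℝ → ℂ) (h : BddMul a) : L2R →L[ℂ] L2R :=
  (mulLin a h).mkContinuousOfExistsBound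
    ⟨h.2.choose, norm_mulLin_le h h.2.choose_spec⟩

theorem coeFn_mulOp {a : ℝ → ℂ} (h : BddMul a) (f : L2R) :
    mulOp a h f =ᵐ[volume] fun x => a x * f x := coeFn_mulLin h f

theorem norm_mulOp_apply_le {a : ℝ → ℂ} (h : BddMul a) {C : ℝ} (hC : ∀ x, ‖a x‖ ≤ C) (f : L2R) :
    ‖mulOp a h f‖ ≤ C * ‖f‖ := norm_mulLin_le h hC f

theorem norm_mulOp_le {a : ℝ → ℂ} (h : BddMul a) {C : ℝ} (hC : ∀ x, ‖a x‖ ≤ C) :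
    ‖mulOp a h‖ ≤ C :=
  ContinuousLinearMap.opNorm_le_bound _ ((norm_nonneg _).trans (hC 0)) (norm_mulOp_apply_le h hC)

theorem mulOp_apply_eq {a : ℝ → ℂ} (h : BddMul a) {f g : L2R}
    (hfg : (fun x => a x * f x) =ᵐ[volume] g) : mulOp a h f = g :=
  Lp.ext ((coeFn_mulOp h f).trans hfg)

theorem mulOp_mulOp_apply {a b c : ℝ → ℂ} (ha : BddMul a) (hb : BddMul b) (hc : BddMul c)
    (habc : ∀ᵐ x, a x * b x = c x) (f : L2R) :
    mulOp a ha (mulOp b hb f) = mulOp c hc f := by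
  refine mulOp_apply_eq ha ?_
  filter_upwards [habc, coeFn_mulOp hb f, coeFn_mulOp hc f] with x h1 h2 h3
  rw [h2, h3, ← h1, mul_assoc]

theorem inner_mulOp_left {a b : ℝ → ℂ} (ha : BddMul a) (hb : BddMul b)
    (hab : ∀ x, conj (a x) = b x) (f g : L2R) :
    inner ℂ (mulOp a ha f) g = inner ℂ f (mulOp b hb g) := by
  rw [L2.inner_def, L2.inner_def]
  refine integral_congr_ae ?_
  filter_upwards [coeFn_mulOp ha f, coeFn_mulOp hb g] with x h1 h2
  rw [h1, h2, RCLike.inner_apply, RCLike.inner_apply, map_mul, ← hab x]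
  ring

theorem BddMul.ofReal {r : ℝ → ℝ} (hr : Measurable r) {C : ℝ} (hC : ∀ x, |r x| ≤ C) :
    BddMul (fun x => (r x : ℂ)) :=
  ⟨Complex.measurable_ofReal.comp hr, C, fun x => by simpa using hC x⟩

/-! ### Complex powers of a multiplier and three-lines interpolation. -/

/-- A bounded measurable real exponent. -/
def BddReal (l : ℝ → ℝ) : Prop := Measurable l ∧ ∃ C, ∀ x, |l x| ≤ C

theorem BddReal.exp {l : ℝ → ℝ} (h : BddReal l) (z : ℂ) :
    BddMul (fun x => Complex.exp (z * l x)) := by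
  obtain ⟨hm, C, hC⟩ := h
  refine ⟨by fun_prop, Real.exp (‖z‖ * C), fun x => ?_⟩
  refine (Complex.norm_exp_le_exp_norm _).trans (Real.exp_le_exp.2 ?_)
  rw [norm_mul, Complex.norm_real]
  exact mul_le_mul_of_nonneg_left (hC x) (norm_nonneg _)

/-- The operator of multiplication by `exp (z l)`. -/
def expOp (l : ℝ → ℝ) (h : BddReal l) (z : ℂ) : L2R →L[ℂ] L2R := mulOp _ (h.exp z)

theorem expOp_add {l : ℝ → ℝ} (h : BddReal l) (z w : ℂ) :
    expOp l h (z + w) = expOp l h z ∘L expOp l h w := by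
  ext1 f
  exact (mulOp_mulOp_apply (h.exp z) (h.exp w) (h.exp (z + w))
    (Eventually.of_forall fun x => by rw [← Complex.exp_add]; ring_nf) f).symm

theorem norm_expOp_le_one {l : ℝ → ℝ} (h : BddReal l) {z : ℂ} (hz : z.re = 0) :
    ‖expOp l h z‖ ≤ 1 := by
  refine norm_mulOp_le _ fun x => ?_
  rw [Complex.norm_exp]
  simp [hz]

/-- Because `l` is bounded, `|exp (w l) - 1 - w l| ≤ |w l|²` holds uniformly in `x` for small `w`,
which is differentiability at 0 in operator norm; the group law `expOp_add` carries it to every `z`.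
-/
theorem differentiableAt_expOp {l : ℝ → ℝ} (h : BddReal l) (z : ℂ) :
    DifferentiableAt ℂ (expOp l h) z := by
  obtain ⟨hm, C, hC⟩ := h
  have hl : BddMul (fun x => (l x : ℂ)) := BddMul.ofReal hm hC
  have h : BddReal l := ⟨hm, C, hC⟩
  have hC0 : 0 ≤ C := (abs_nonneg _).trans (hC 0)
  have h0 : HasDerivAt (expOp l h) (mulOp _ hl) 0 := by
    rw [hasDerivAt_iff_isLittleO_nhds_zero]
    refine (Asymptotics.isBigO_iff.2 ⟨C ^ 2, ?_⟩ :
      _ =O[𝓝 0] fun w : ℂ => w ^ 2).trans_isLittleO ?_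
    · have hev : ∀ᶠ w : ℂ in 𝓝 0, ‖w‖ * C < 1 := by
        have : Tendsto (fun w : ℂ => ‖w‖ * C) (𝓝 0) (𝓝 0) := by
          have : Continuous (fun w : ℂ => ‖w‖ * C) := by fun_prop
          simpa using this.tendsto 0
        exact this.eventually_lt_const one_pos
      filter_upwards [hev] with w hw
      rw [zero_add]
      refine ContinuousLinearMap.opNorm_le_bound _ (by positivity) fun f => ?_
      refine Lp.norm_le_mul_norm_of_ae_le_mul ?_
      have e0 : (expOp l h 0) f = f := mulOp_apply_eq _ (by simp)
      have e1 : (expOp l h w - expOp l h 0 - w • mulOp _ hl) f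
          = expOp l h w f - f - w • mulOp _ hl f := by
        simp [e0]
      rw [e1]
      filter_upwards [coeFn_mulOp (h.exp w) f, coeFn_mulOp hl f,
        Lp.coeFn_sub (expOp l h w f - f) (w • mulOp _ hl f),
        Lp.coeFn_sub (expOp l h w f) f, Lp.coeFn_smul w (mulOp _ hl f)] with x h1 h2 h3 h4 h5
      rw [h3, Pi.sub_apply, h4, Pi.sub_apply, h5, Pi.smul_apply, h2, expOp, h1]
      have e2 : Complex.exp (w * l x) * f x - f x - w • ((l x : ℂ) * f x)
          = (Complex.exp (w * l x) - 1 - w * l x) * f x := by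
        rw [smul_eq_mul]; ring
      have h6 : ‖w * (l x : ℂ)‖ ≤ ‖w‖ * C := by
        rw [norm_mul, Complex.norm_real]
        exact mul_le_mul_of_nonneg_left (hC x) (norm_nonneg _)
      rw [e2, norm_mul]
      refine mul_le_mul_of_nonneg_right ?_ (norm_nonneg _)
      refine (Complex.norm_exp_sub_one_sub_id_le (h6.trans hw.le)).trans ?_
      rw [norm_pow, ← mul_pow, mul_comm C]
      exact pow_le_pow_left₀ (norm_nonneg _) h6 2
    · have : (fun w : ℂ => w ^ 2) =o[𝓝 0] fun w : ℂ => w ^ 1 :=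
        Asymptotics.isLittleO_pow_pow (by norm_num)
      simpa using this
  have h1 : expOp l h = fun w => expOp l h z ∘L expOp l h (w - z) := by
    funext w
    rw [← expOp_add, add_sub_cancel]
  rw [h1]
  have h2 : DifferentiableAt ℂ (fun w => expOp l h (w - z)) z := by
    have h3 : DifferentiableAt ℂ (expOp l h) (z - z) := by
      rw [sub_self]; exact h0.differentiableAt
    exact DifferentiableAt.comp (f := fun w : ℂ => w - z) z h3 (by fun_prop)
  exact (differentiableAt_const _).clm_comp h2

/-- Interpolation of a bounded operator between weighted `L²` spaces. -/
theorem norm_expOp_interpolation {l : ℝ → ℝ} (h : BddReal l) (T : L2R →L[ℂ] L2R) {N₀ N₁ : ℝ}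
    (h0 : ‖expOp l h (1 / 4) ∘L T ∘L expOp l h (1 / 4)‖ ≤ N₀)
    (h1 : ‖expOp l h (1 / 2) ∘L T‖ ≤ N₁) {τ : ℝ} (hτ0 : 0 ≤ τ) (hτ1 : τ ≤ 1) :
    ‖expOp l h ((1 + τ) / 4) ∘L T ∘L expOp l h ((1 - τ) / 4)‖ ≤ N₀ ^ (1 - τ) * N₁ ^ τ := by
  set Φ : ℂ → L2R →L[ℂ] L2R :=
    fun z => expOp l h ((1 + z) / 4) ∘L T ∘L expOp l h ((1 - z) / 4) with hΦ
  have hdiff : Differentiable ℂ Φ := fun z => by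
    have e1 : DifferentiableAt ℂ (fun z : ℂ => expOp l h ((1 + z) / 4)) z :=
      (differentiableAt_expOp h _).comp z (by fun_prop)
    have e2 : DifferentiableAt ℂ (fun z : ℂ => expOp l h ((1 - z) / 4)) z :=
      (differentiableAt_expOp h _).comp z (by fun_prop)
    exact e1.clm_comp ((differentiableAt_const T).clm_comp e2)
  -- The imaginary part of the argument contributes only contractions (unimodular multipliers), so
  -- the norm on a vertical line is controlled by its value on the real axis.
  have key : ∀ (x y : ℝ), Φ (x + y * Complex.I) = expOp l h (y / 4 * Complex.I) ∘L Φ x ∘L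
      expOp l h (-(y / 4) * Complex.I) := fun x y => by
    simp only [hΦ]
    rw [show ((1 + ((x : ℂ) + y * Complex.I)) / 4) = y / 4 * Complex.I + (1 + x) / 4 by ring,
      show ((1 - ((x : ℂ) + y * Complex.I)) / 4) = (1 - x) / 4 + -(y / 4) * Complex.I by ring,
      expOp_add, expOp_add]
    rfl
  have hle : ∀ x y : ℝ, ‖Φ (x + y * Complex.I)‖ ≤ ‖Φ x‖ := fun x y => by
    rw [key]
    refine (ContinuousLinearMap.opNorm_comp_le _ _).trans ?_
    have a1 := norm_expOp_le_one h (z := y / 4 * Complex.I) (by simp)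
    have a2 := norm_expOp_le_one h (z := -(y / 4) * Complex.I) (by simp)
    have a3 := ContinuousLinearMap.opNorm_comp_le (Φ x) (expOp l h (-(y / 4) * Complex.I))
    have a4 : ‖Φ x‖ * ‖expOp l h (-(y / 4) * Complex.I)‖ ≤ ‖Φ x‖ :=
      mul_le_of_le_one_right (norm_nonneg _) a2
    exact (mul_le_of_le_one_left (norm_nonneg _) a1).trans (a3.trans a4)
  have hle' : ∀ z : ℂ, ‖Φ z‖ ≤ ‖Φ z.re‖ := fun z => by
    have := hle z.re z.im
    rwa [Complex.re_add_im] at this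
  have hres := Complex.HadamardThreeLines.norm_le_interp_of_mem_verticalClosedStrip₀₁' Φ
    (z := τ) (a := N₀) (b := N₁) ⟨by simpa using hτ0, by simpa using hτ1⟩
    hdiff.diffContOnCl ?_ ?_ ?_
  · simpa [hΦ] using hres
  · have hc : ContinuousOn (fun x : ℝ => ‖Φ x‖) (Icc 0 1) :=
      (hdiff.continuous.comp Complex.continuous_ofReal).norm.continuousOn
    obtain ⟨C, hC⟩ := isCompact_Icc.bddAbove_image hc
    refine ⟨C, ?_⟩
    rintro _ ⟨z, hz, rfl⟩
    exact (hle' z).trans (hC ⟨z.re, hz, rfl⟩)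
  · intro z hz
    have hz : z.re = 0 := hz
    refine (hle' z).trans ?_
    simpa [hΦ, hz] using h0
  · intro z hz
    have hz : z.re = 1 := hz
    refine (hle' z).trans ?_
    rw [hz]
    have e : expOp l h 0 = ContinuousLinearMap.id ℂ L2R := by
      ext1 f
      exact mulOp_apply_eq _ (by simp)
    have e2 : ((1 + ((1 : ℝ) : ℂ)) / 4) = 1 / 2 := by norm_num
    simp only [hΦ, e2]
    simpa [e] using h1

/-! ### Operators `1 + D B D` with `D` symmetric and `B` accretive. -/

section Hilbert

variable {H : Type*} [NormedAddCommGroup H] [InnerProductSpace ℂ H]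

/-- The operator `1 + D B D`. -/
def oneAddConj (D B : H →L[ℂ] H) : H →L[ℂ] H := 1 + D ∘L B ∘L D

theorem sq_norm_le_re_inner_oneAddConj {D B : H →L[ℂ] H}
    (hD : ∀ x y, inner ℂ (D x) y = inner ℂ x (D y))
    (hB : ∀ x, 0 ≤ RCLike.re (inner ℂ x (B x))) (x : H) :
    ‖x‖ ^ 2 ≤ RCLike.re (inner ℂ x (oneAddConj D B x)) := by
  have : oneAddConj D B x = x + D (B (D x)) := rfl
  rw [this, inner_add_right, map_add, ← hD, inner_self_eq_norm_sq]
  linarith [hB (D x)]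

/-- Lax–Milgram with coercivity constant 1. -/
theorem isUnit_oneAddConj [CompleteSpace H] {D B : H →L[ℂ] H}
    (hD : ∀ x y, inner ℂ (D x) y = inner ℂ x (D y))
    (hB : ∀ x, 0 ≤ RCLike.re (inner ℂ x (B x))) : IsUnit (oneAddConj D B) := by
  refine ContinuousLinearMap.isUnit_of_forall_le_norm_inner_map _ (c := 1) one_pos fun x => ?_
  rw [NNReal.coe_one, mul_one, norm_inner_symm]
  exact (sq_norm_le_re_inner_oneAddConj hD hB x).trans (RCLike.re_le_norm _)

theorem norm_le_norm_oneAddConj {D B : H →L[ℂ] H}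
    (hD : ∀ x y, inner ℂ (D x) y = inner ℂ x (D y))
    (hB : ∀ x, 0 ≤ RCLike.re (inner ℂ x (B x))) (x : H) : ‖x‖ ≤ ‖oneAddConj D B x‖ := by
  have h1 := (sq_norm_le_re_inner_oneAddConj hD hB x).trans
    ((RCLike.re_le_norm _).trans (norm_inner_le_norm x _))
  rcases (norm_nonneg x).eq_or_lt with h | h
  · rw [← h]; exact norm_nonneg _
  · rw [pow_two] at h1
    exact le_of_mul_le_mul_left h1 h

/-- Pairing the equation with `v` gives `‖v‖² + Re ⟨Dv, B D v⟩ = Re ⟨Dv, φ⟩`. Since `‖v‖² ≥ ‖Dv‖² /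
c`, the claim follows from `a b - a² / c ≤ c b² / 4` with `a = ‖Dv‖`, `b = ‖φ‖`. -/
theorem re_inner_le_of_oneAddConj {D B : H →L[ℂ] H}
    (hD : ∀ x y, inner ℂ (D x) y = inner ℂ x (D y))
    {c : ℝ} (hc : 0 < c) (hDc : ∀ x, ‖D x‖ ^ 2 ≤ c * ‖x‖ ^ 2)
    {v φ : H} (hv : oneAddConj D B v = D φ) :
    RCLike.re (inner ℂ (D v) (B (D v))) ≤ c / 4 * ‖φ‖ ^ 2 := by
  have h1 : v + D (B (D v)) = D φ := hv
  have h2 : inner ℂ v v + inner ℂ (D v) (B (D v)) = inner ℂ (D v) φ := by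
    rw [hD v, hD v, ← inner_add_right, h1]
  have h3 := congrArg RCLike.re h2
  rw [map_add, inner_self_eq_norm_sq] at h3
  have h4 : RCLike.re (inner ℂ (D v) φ) ≤ ‖D v‖ * ‖φ‖ :=
    (RCLike.re_le_norm _).trans (norm_inner_le_norm _ _)
  have h5 := hDc v
  have h6 : c * (‖D v‖ * ‖φ‖) ≤ ‖D v‖ ^ 2 + c ^ 2 / 4 * ‖φ‖ ^ 2 := by
    nlinarith [sq_nonneg (‖D v‖ - c / 2 * ‖φ‖)]
  have h7 : c * RCLike.re (inner ℂ (D v) (B (D v))) ≤ c * (c / 4 * ‖φ‖ ^ 2) := by nlinarith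
  exact le_of_mul_le_mul_left h7 hc

end Hilbert

/-! ### Elementary bounds for `t coth t`. -/

theorem nonneg_of_hasDerivAt_nonneg {f f' : ℝ → ℝ} (hf : ∀ x, HasDerivAt f (f' x) x)
    (h0 : 0 ≤ f 0) (h' : ∀ x, 0 < x → 0 ≤ f' x) {x : ℝ} (hx : 0 ≤ x) : 0 ≤ f x := by
  have hm : MonotoneOn f (Ici 0) := by
    refine monotoneOn_of_deriv_nonneg (convex_Ici 0)
      (fun y _ => (hf y).continuousAt.continuousWithinAt)
      (fun y _ => (hf y).differentiableAt.differentiableWithinAt) fun y hy => ?_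
    rw [interior_Ici] at hy
    rw [(hf y).deriv]
    exact h' y hy
  exact h0.trans (hm (mem_Ici.2 le_rfl) hx hx)

theorem sinh_le_mul_cosh {t : ℝ} (ht : 0 ≤ t) : Real.sinh t ≤ t * Real.cosh t := by
  have h := nonneg_of_hasDerivAt_nonneg (f := fun t => t * Real.cosh t - Real.sinh t)
    (f' := fun t => t * Real.sinh t)
    (fun x => (((hasDerivAt_id x).mul (Real.hasDerivAt_cosh x)).sub
      (Real.hasDerivAt_sinh x)).congr_deriv (by simp))
    (by simp) (fun x hx => mul_nonneg hx.le (Real.sinh_nonneg_iff.2 hx.le)) ht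
  linarith

theorem one_sub_mul_sinh_le {t : ℝ} (ht : 0 ≤ t) : (1 - t ^ 2 / 6) * Real.sinh t ≤ t := by
  have h1 : ∀ x : ℝ, 0 ≤ x →
      0 ≤ 1 - (1 - x ^ 2 / 6) * Real.cosh x + x / 3 * Real.sinh x := fun x hx => by
    refine nonneg_of_hasDerivAt_nonneg
      (f := fun x => 1 - (1 - x ^ 2 / 6) * Real.cosh x + x / 3 * Real.sinh x)
      (f' := fun x => 2 / 3 * (x * Real.cosh x - Real.sinh x) + x ^ 2 / 6 * Real.sinh x)
      (fun x => ?_) (by simp) (fun x hx => ?_) hx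
    · have e1 : HasDerivAt (fun x : ℝ => 1 - x ^ 2 / 6) (-(x / 3)) x :=
        ((((hasDerivAt_id x).pow 2).div_const 6).const_sub 1).congr_deriv (by simp; ring)
      have e2 : HasDerivAt (fun x : ℝ => x / 3) (1 / 3) x := (hasDerivAt_id x).div_const 3
      exact (((e1.mul (Real.hasDerivAt_cosh x)).const_sub 1).add
        (e2.mul (Real.hasDerivAt_sinh x))).congr_deriv (by ring)
    · have := sinh_le_mul_cosh hx.le
      have := Real.sinh_nonneg_iff.2 hx.le
      have : 0 ≤ x ^ 2 / 6 * Real.sinh x := by positivity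
      linarith
  have h := nonneg_of_hasDerivAt_nonneg (f := fun x => x - (1 - x ^ 2 / 6) * Real.sinh x)
    (f' := fun x => 1 - (1 - x ^ 2 / 6) * Real.cosh x + x / 3 * Real.sinh x)
    (fun x => by
      have e1 : HasDerivAt (fun x : ℝ => 1 - x ^ 2 / 6) (-(x / 3)) x :=
        ((((hasDerivAt_id x).pow 2).div_const 6).const_sub 1).congr_deriv (by simp; ring)
      exact ((hasDerivAt_id x).sub (e1.mul (Real.hasDerivAt_sinh x))).congr_deriv (by ring))
    (by simp) (fun x hx => h1 x hx.le) ht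
  linarith

/-- By `cosh² = 1 + sinh²` this says `sinh² t (1 - 5t²/9) ≤ t²`. For `t² ≤ 6` square
`one_sub_mul_sinh_le` and use `1 - 5t²/9 ≤ (1 - t²/6)²`; for larger `t` the left side is not
positive. The coefficient `4/9` is chosen so that, at `t = π ξ`, `π ≥ 3` recovers `4 ξ²`. -/
theorem one_add_sq_mul_sinh_sq_le {t : ℝ} (ht : 0 ≤ t) :
    (1 + 4 * t ^ 2 / 9) * Real.sinh t ^ 2 ≤ t ^ 2 * Real.cosh t ^ 2 := by
  rw [Real.cosh_sq]
  have hs : 0 ≤ Real.sinh t := Real.sinh_nonneg_iff.2 ht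
  suffices h : Real.sinh t ^ 2 * (1 - 5 * t ^ 2 / 9) ≤ t ^ 2 by nlinarith
  by_cases h6 : t ^ 2 ≤ 6
  · have h1 := one_sub_mul_sinh_le ht
    have h2 : ((1 - t ^ 2 / 6) * Real.sinh t) ^ 2 ≤ t ^ 2 :=
      pow_le_pow_left₀ (mul_nonneg (by linarith) hs) h1 2
    have h3 : 1 - 5 * t ^ 2 / 9 ≤ (1 - t ^ 2 / 6) ^ 2 := by nlinarith [sq_nonneg t]
    calc _ ≤ Real.sinh t ^ 2 * (1 - t ^ 2 / 6) ^ 2 :=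
          mul_le_mul_of_nonneg_left h3 (sq_nonneg _)
      _ ≤ t ^ 2 := by rw [mul_pow] at h2; linarith
  · have : Real.sinh t ^ 2 * (1 - 5 * t ^ 2 / 9) ≤ 0 :=
      mul_nonpos_of_nonneg_of_nonpos (sq_nonneg _) (by linarith)
    nlinarith [sq_nonneg t]

theorem sqrt_le_mul_coth {t : ℝ} (ht : t ≠ 0) :
    √(1 + 4 * t ^ 2 / 9) ≤ t * (Real.cosh t / Real.sinh t) := by
  wlog h : 0 < t generalizing t with H
  · have := H (t := -t) (neg_ne_zero.2 ht) (neg_pos.2 (lt_of_le_of_ne (not_lt.1 h) ht))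
    simpa [neg_sq, Real.cosh_neg, Real.sinh_neg, div_neg] using this
  have hs : 0 < Real.sinh t := Real.sinh_pos_iff.2 h
  refine Real.sqrt_le_iff.2 ⟨by have := Real.cosh_pos t; positivity, ?_⟩
  rw [mul_pow, div_pow, mul_div_assoc', le_div_iff₀ (by positivity)]
  exact one_add_sq_mul_sinh_sq_le h.le

theorem mul_coth_le {t : ℝ} (ht : t ≠ 0) :
    t * (Real.cosh t / Real.sinh t) ≤ 1 + |t| := by
  wlog h : 0 < t generalizing t with H
  · have := H (t := -t) (neg_ne_zero.2 ht) (neg_pos.2 (lt_of_le_of_ne (not_lt.1 h) ht))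
    simpa [Real.cosh_neg, Real.sinh_neg, div_neg] using this
  have hs : 0 < Real.sinh t := Real.sinh_pos_iff.2 h
  rw [abs_of_pos h, mul_div_assoc', div_le_iff₀ hs]
  have h1 : t ≤ Real.sinh t := Real.self_le_sinh_iff.2 h.le
  have h2 : Real.cosh t - Real.sinh t ≤ 1 := by
    rw [Real.cosh_sub_sinh]; exact Real.exp_le_one_iff.2 (by linarith)
  nlinarith

/-! ### The weight, the symbol `ξ coth (π ξ)` and their comparison. -/

/-- The weight `1 + 4 ξ²` in the variable `ζ = ξ / π`. -/
def weight (ζ : ℝ) : ℝ := 1 + 4 * (Real.pi * ζ) ^ 2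

theorem one_le_weight (ζ : ℝ) : 1 ≤ weight ζ := by
  unfold weight; nlinarith [sq_nonneg (Real.pi * ζ)]

theorem weight_pos (ζ : ℝ) : 0 < weight ζ := one_pos.trans_le (one_le_weight ζ)

theorem measurable_weight : Measurable weight := by unfold weight; fun_prop

/-- The symbol `ξ coth (π ξ)` in the variable `ζ = ξ / π`. -/
def cothSymbol (ζ : ℝ) : ℝ :=
  Real.pi * ζ * (Real.cosh (Real.pi * (Real.pi * ζ)) / Real.sinh (Real.pi * (Real.pi * ζ)))

theorem measurable_cothSymbol : Measurable cothSymbol := by unfold cothSymbol; fun_prop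

theorem sqrt_weight_le {ζ : ℝ} (hζ : ζ ≠ 0) : √(weight ζ) ≤ Real.pi * cothSymbol ζ := by
  have hp := Real.pi_pos
  have hp3 := Real.pi_gt_three
  have h := sqrt_le_mul_coth (t := Real.pi * (Real.pi * ζ)) (by positivity)
  refine (Real.sqrt_le_sqrt ?_).trans (h.trans_eq (by unfold cothSymbol; ring))
  unfold weight
  have h9 : 9 ≤ Real.pi ^ 2 := by nlinarith
  have : 0 ≤ (Real.pi ^ 2 - 9) * (Real.pi * ζ) ^ 2 :=
    mul_nonneg (by linarith) (sq_nonneg _)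
  nlinarith

theorem cothSymbol_pos {ζ : ℝ} (hζ : ζ ≠ 0) : 0 < cothSymbol ζ :=
  pos_of_mul_pos_right ((Real.sqrt_pos.2 (weight_pos ζ)).trans_le (sqrt_weight_le hζ))
    Real.pi_pos.le

/-- Only needed to see that every element of `H̃^{1/2}` has finite energy for the symbol
(`ofEnergy_surjective`); the constant 2 does not enter the final estimate. -/
theorem cothSymbol_le {ζ : ℝ} (hζ : ζ ≠ 0) : cothSymbol ζ ≤ 2 * √(weight ζ) := by
  have hp := Real.pi_pos
  have hp3 := Real.pi_gt_three
  have h := mul_coth_le (t := Real.pi * (Real.pi * ζ)) (by positivity)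
  have e : Real.pi * (Real.pi * ζ) * (Real.cosh (Real.pi * (Real.pi * ζ)) /
      Real.sinh (Real.pi * (Real.pi * ζ))) = Real.pi * cothSymbol ζ := by
    unfold cothSymbol; ring
  rw [e, abs_mul, abs_of_pos hp] at h
  have h1 : 1 ≤ √(weight ζ) := Real.one_le_sqrt.2 (one_le_weight ζ)
  have h2 : |Real.pi * ζ| ≤ √(weight ζ) := by
    refine Real.abs_le_sqrt ?_
    unfold weight; nlinarith [sq_nonneg (Real.pi * ζ)]
  have h3 : Real.pi * cothSymbol ζ ≤ Real.pi * (2 * √(weight ζ)) := by nlinarith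
  exact le_of_mul_le_mul_left h3 hp

/-- `m ^ (-1/2)` for the symbol `m = ξ coth (π ξ)`. -/
def dSymbol (ζ : ℝ) : ℝ := (√(cothSymbol ζ))⁻¹

theorem measurable_dSymbol : Measurable dSymbol := by
  unfold dSymbol; exact measurable_cothSymbol.sqrt.inv

theorem dSymbol_nonneg (ζ : ℝ) : 0 ≤ dSymbol ζ := by unfold dSymbol; positivity

theorem dSymbol_sq_mul {ζ : ℝ} (hζ : ζ ≠ 0) : dSymbol ζ ^ 2 * cothSymbol ζ = 1 := by
  have h := cothSymbol_pos hζ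
  rw [dSymbol, inv_pow, Real.sq_sqrt h.le, inv_mul_cancel₀ h.ne']

theorem sqrt_weight_mul_dSymbol_sq_le (ζ : ℝ) : √(weight ζ) * dSymbol ζ ^ 2 ≤ Real.pi := by
  by_cases hζ : ζ = 0
  -- At 0 division by zero makes `cothSymbol`, and hence `dSymbol`, equal to 0 instead of the limit
  -- value; the bound survives trivially, so it holds everywhere.
  · simpa [hζ, dSymbol, cothSymbol] using Real.pi_pos.le
  · have h := mul_le_mul_of_nonneg_right (sqrt_weight_le hζ) (sq_nonneg (dSymbol ζ))
    refine h.trans_eq ?_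
    rw [mul_assoc, mul_comm (cothSymbol ζ), dSymbol_sq_mul hζ, mul_one]

theorem dSymbol_sq_le (ζ : ℝ) : dSymbol ζ ^ 2 ≤ Real.pi :=
  (le_mul_of_one_le_left (sq_nonneg _) (Real.one_le_sqrt.2 (one_le_weight ζ))).trans
    (sqrt_weight_mul_dSymbol_sq_le ζ)

theorem rpow_mul_dSymbol_le {ζ y r : ℝ} (hy : 0 < y) (hyw : y ≤ weight ζ) (hr0 : 0 ≤ r)
    (hr : r ≤ 1 / 4) : y ^ r * dSymbol ζ ≤ √Real.pi := by
  refine Real.le_sqrt_of_sq_le ?_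
  rw [mul_pow]
  refine (mul_le_mul_of_nonneg_right ?_ (sq_nonneg _)).trans (sqrt_weight_mul_dSymbol_sq_le ζ)
  rw [← Real.rpow_natCast, ← Real.rpow_mul hy.le, Real.sqrt_eq_rpow]
  exact (Real.rpow_le_rpow hy.le hyw (by positivity)).trans
    (Real.rpow_le_rpow_of_exponent_le (one_le_weight ζ) (by push_cast; linarith))

/-! ### Truncated weights and the resolvent estimate. -/

/-- The truncated weight. -/
def truncWeight (n : ℕ) (ζ : ℝ) : ℝ := min (weight ζ) (n + 1)

theorem one_le_truncWeight (n : ℕ) (ζ : ℝ) : 1 ≤ truncWeight n ζ :=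
  le_min (one_le_weight ζ) (by simp)

theorem truncWeight_pos (n : ℕ) (ζ : ℝ) : 0 < truncWeight n ζ :=
  one_pos.trans_le (one_le_truncWeight n ζ)

theorem truncWeight_le (n : ℕ) (ζ : ℝ) : truncWeight n ζ ≤ weight ζ := min_le_left _ _

theorem truncWeight_mono (ζ : ℝ) : Monotone fun n => truncWeight n ζ := fun m n h =>
  min_le_min_left _ (by have : (m : ℝ) ≤ n := Nat.cast_le.2 h
                        linarith)

theorem tendsto_truncWeight (ζ : ℝ) : Tendsto (fun n => truncWeight n ζ) atTop (𝓝 (weight ζ)) := by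
  refine tendsto_const_nhds.congr' ?_
  obtain ⟨N, hN⟩ := exists_nat_ge (weight ζ)
  filter_upwards [eventually_ge_atTop N] with n hn
  have : (N : ℝ) ≤ n := Nat.cast_le.2 hn
  exact (min_eq_left (by linarith)).symm

theorem measurable_truncWeight (n : ℕ) : Measurable (truncWeight n) :=
  measurable_weight.min measurable_const

theorem bddReal_log_truncWeight (n : ℕ) : BddReal fun ζ => Real.log (truncWeight n ζ) := by
  refine ⟨(measurable_truncWeight n).log, Real.log (n + 1), fun ζ => ?_⟩
  rw [abs_of_nonneg (Real.log_nonneg (one_le_truncWeight n ζ))]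
  exact Real.log_le_log (truncWeight_pos n ζ) (min_le_right _ _)

/-- Multiplication by the `z`-th power of the truncated weight. -/
def truncPow (n : ℕ) (z : ℂ) : L2R →L[ℂ] L2R := expOp _ (bddReal_log_truncWeight n) z

theorem exp_mul_log_truncWeight (n : ℕ) (r ζ : ℝ) :
    Complex.exp ((r : ℂ) * (Real.log (truncWeight n ζ) : ℂ)) = ((truncWeight n ζ ^ r : ℝ) : ℂ) := by
  rw [Real.rpow_def_of_pos (truncWeight_pos n ζ), mul_comm]
  push_cast
  rfl

theorem coeFn_truncPow (n : ℕ) (r : ℝ) (f : L2R) :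
    truncPow n r f =ᵐ[volume] fun ζ => ((truncWeight n ζ ^ r : ℝ) : ℂ) * f ζ := by
  filter_upwards [coeFn_mulOp ((bddReal_log_truncWeight n).exp r) f] with ζ hζ
  rw [← exp_mul_log_truncWeight]
  exact hζ

theorem norm_truncPow_mono {m n : ℕ} (hmn : m ≤ n) {r : ℝ} (hr : 0 ≤ r) (f : L2R) :
    ‖truncPow m r f‖ ≤ ‖truncPow n r f‖ := by
  refine Lp.norm_le_norm_of_ae_le ?_
  filter_upwards [coeFn_truncPow m r f, coeFn_truncPow n r f] with ζ h1 h2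
  have h0 : 0 ≤ truncWeight m ζ ^ r := Real.rpow_nonneg (truncWeight_pos m ζ).le _
  have h3 : truncWeight m ζ ^ r ≤ truncWeight n ζ ^ r :=
    Real.rpow_le_rpow (truncWeight_pos m ζ).le (truncWeight_mono ζ hmn) hr
  rw [h1, h2, norm_mul, norm_mul, Complex.norm_real, Complex.norm_real, Real.norm_of_nonneg h0,
    Real.norm_of_nonneg (h0.trans h3)]
  exact mul_le_mul_of_nonneg_right h3 (norm_nonneg _)

theorem bddMul_dSymbol : BddMul fun ζ => (dSymbol ζ : ℂ) :=
  BddMul.ofReal measurable_dSymbol (C := √Real.pi) fun ζ => by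
    rw [abs_of_nonneg (dSymbol_nonneg ζ)]
    exact Real.le_sqrt_of_sq_le (dSymbol_sq_le ζ)

/-- Multiplication by `m ^ (-1/2)`, for the symbol `m = ξ coth (π ξ)`. -/
def dOp : L2R →L[ℂ] L2R := mulOp _ bddMul_dSymbol

theorem inner_dOp (x y : L2R) : inner ℂ (dOp x) y = inner ℂ x (dOp y) :=
  inner_mulOp_left _ _ (fun _ => Complex.conj_ofReal _) x y

theorem norm_dOp_sq_le (x : L2R) : ‖dOp x‖ ^ 2 ≤ Real.pi * ‖x‖ ^ 2 := by
  have h : ‖dOp x‖ ≤ √Real.pi * ‖x‖ := norm_mulOp_apply_le _ (fun ζ => by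
    rw [Complex.norm_real, Real.norm_of_nonneg (dSymbol_nonneg ζ)]
    exact Real.le_sqrt_of_sq_le (dSymbol_sq_le ζ)) x
  have h2 := pow_le_pow_left₀ (norm_nonneg _) h 2
  rwa [mul_pow, Real.sq_sqrt Real.pi_pos.le] at h2

theorem norm_truncPow_dOp_le (n : ℕ) (x : L2R) : ‖truncPow n (1 / 4) (dOp x)‖ ≤ √Real.pi * ‖x‖ := by
  refine Lp.norm_le_mul_norm_of_ae_le_mul ?_
  have e : (1 / 4 : ℂ) = ((1 / 4 : ℝ) : ℂ) := by norm_num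
  rw [e]
  filter_upwards [coeFn_truncPow n (1 / 4) (dOp x), coeFn_mulOp bddMul_dSymbol x] with ζ h1 h2
  rw [h1, dOp, h2, ← mul_assoc, ← Complex.ofReal_mul, norm_mul, Complex.norm_real,
    Real.norm_of_nonneg (mul_nonneg (Real.rpow_nonneg (truncWeight_pos n ζ).le _)
      (dSymbol_nonneg ζ))]
  exact mul_le_mul_of_nonneg_right (rpow_mul_dSymbol_le (truncWeight_pos n ζ) (truncWeight_le n ζ)
    (by norm_num) le_rfl) (norm_nonneg _)

theorem truncPow_dOp_comm (n : ℕ) (z : ℂ) (x : L2R) :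
    truncPow n z (dOp x) = dOp (truncPow n z x) := by
  refine Lp.ext ?_
  filter_upwards [coeFn_mulOp ((bddReal_log_truncWeight n).exp z) (dOp x),
    coeFn_mulOp bddMul_dSymbol x, coeFn_mulOp bddMul_dSymbol (truncPow n z x),
    coeFn_mulOp ((bddReal_log_truncWeight n).exp z) x] with ζ h1 h2 h3 h4
  simp only [truncPow, expOp, dOp] at h1 h2 h3 h4 ⊢
  rw [h1, h2, h3, h4]
  ring

/-- The half power splits into two quarter powers, each absorbed by one factor `dOp` at the cost
`√π`. -/
theorem norm_truncPow_dOp_dOp_le (n : ℕ) (x : L2R) :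
    ‖truncPow n (1 / 2) (dOp (dOp x))‖ ≤ Real.pi * ‖x‖ := by
  have e : truncPow n (1 / 2) (dOp (dOp x))
      = truncPow n (1 / 4) (dOp (truncPow n (1 / 4) (dOp x))) := by
    rw [← truncPow_dOp_comm n _ (dOp x)]
    have : truncPow n (1 / 2) = truncPow n (1 / 4) ∘L truncPow n (1 / 4) := by
      rw [truncPow, truncPow, ← expOp_add]
      norm_num
    rw [this]; rfl
  rw [e]
  refine (norm_truncPow_dOp_le n _).trans ?_
  refine (mul_le_mul_of_nonneg_left (norm_truncPow_dOp_le n x) (Real.sqrt_nonneg _)).trans_eq ?_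
  rw [← mul_assoc, Real.mul_self_sqrt Real.pi_pos.le]

theorem rpow_interp_eq {M θ : ℝ} (hM : 0 ≤ M) :
    Real.pi ^ (1 - 2 * θ) * (√(Real.pi ^ 2 * (2 + Real.pi / 2 * M))) ^ (2 * θ)
      = solutionConst M θ := by
  have hp := Real.pi_pos
  rw [solutionConst, Real.sqrt_eq_rpow, ← Real.rpow_mul (by positivity)]
  congr 2
  ring

/-- The resolvent bound in the scale of truncated weights. -/
theorem norm_truncPow_resolvent_le {B : L2R →L[ℂ] L2R} {M : ℝ} (hM : 0 ≤ M)
    (hB : ∀ x, 0 ≤ RCLike.re (inner ℂ x (B x)))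
    (hBM : ∀ x, ‖B x‖ ^ 2 ≤ M * RCLike.re (inner ℂ x (B x)))
    {R : L2R →L[ℂ] L2R} (hR : ∀ x, oneAddConj dOp B (R x) = x) (n : ℕ) {θ : ℝ} (hθ0 : 0 ≤ θ)
    (hθ1 : θ ≤ 1 / 2) (φ : L2R) :
    ‖truncPow n ((1 + 2 * θ) / 4 : ℝ) (dOp (R (dOp (truncPow n ((1 - 2 * θ) / 4 : ℝ) φ))))‖
      ≤ solutionConst M θ * ‖φ‖ := by
  have hp := Real.pi_pos
  have hRn : ∀ x, ‖R x‖ ≤ ‖x‖ := fun x => by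
    have := norm_le_norm_oneAddConj inner_dOp hB (R x)
    rwa [hR] at this
  -- Endpoint `τ = 0`: `R` is a contraction, and each `dOp` absorbs one quarter power.
  have h0 : ‖truncPow n (1 / 4) ∘L (dOp ∘L R ∘L dOp) ∘L truncPow n (1 / 4)‖ ≤ Real.pi := by
    refine ContinuousLinearMap.opNorm_le_bound _ hp.le fun x => ?_
    refine (norm_truncPow_dOp_le n _).trans ?_
    have : ‖R (dOp (truncPow n (1 / 4) x))‖ ≤ √Real.pi * ‖x‖ := by
      refine (hRn _).trans ?_
      rw [← truncPow_dOp_comm]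
      exact norm_truncPow_dOp_le n x
    refine (mul_le_mul_of_nonneg_left this (Real.sqrt_nonneg _)).trans_eq ?_
    rw [← mul_assoc, Real.mul_self_sqrt hp.le]
  have h1 : ‖truncPow n (1 / 2) ∘L (dOp ∘L R ∘L dOp)‖
      ≤ √(Real.pi ^ 2 * (2 + Real.pi / 2 * M)) := by
    refine ContinuousLinearMap.opNorm_le_bound _ (Real.sqrt_nonneg _) fun x => ?_
    have hv : oneAddConj dOp B (R (dOp x)) = dOp x := hR _
    have hq := re_inner_le_of_oneAddConj inner_dOp hp norm_dOp_sq_le hv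
    -- The regularity gain: solving the equation for its first term exhibits a second factor `dOp`,
    -- enough to absorb the half power at the endpoint `τ = 1`.
    have hv' : R (dOp x) = dOp (x - B (dOp (R (dOp x)))) := by
      have e : R (dOp x) + dOp (B (dOp (R (dOp x)))) = dOp x := hv
      rw [map_sub, eq_sub_iff_add_eq, e]
    set F := dOp (R (dOp x)) with hF
    have h2 : ‖truncPow n (1 / 2) F‖ ≤ Real.pi * ‖x - B F‖ := by
      have hF' : F = dOp (dOp (x - B F)) := congrArg dOp hv'
      calc ‖truncPow n (1 / 2) F‖ = ‖truncPow n (1 / 2) (dOp (dOp (x - B F)))‖ := by rw [← hF']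
        _ ≤ _ := norm_truncPow_dOp_dOp_le n _
    -- Here `(a + b)² ≤ 2a² + 2b²`, with `‖B F‖² ≤ M · (π/4) ‖x‖²` from `hBM` and `hq`.
    have h3 : ‖x - B F‖ ^ 2 ≤ (2 + Real.pi / 2 * M) * ‖x‖ ^ 2 := by
      have h4 : ‖x - B F‖ ≤ ‖x‖ + ‖B F‖ := norm_sub_le _ _
      have h5 := pow_le_pow_left₀ (norm_nonneg _) h4 2
      have h6 := hBM F
      have h7 := mul_le_mul_of_nonneg_left hq hM
      nlinarith [sq_nonneg (‖x‖ - ‖B F‖)]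
    refine h2.trans ?_
    rw [← abs_of_nonneg (norm_nonneg x), ← Real.sqrt_sq_eq_abs, ← Real.sqrt_mul (by positivity)]
    refine Real.le_sqrt_of_sq_le ?_
    rw [mul_pow, mul_assoc]
    exact mul_le_mul_of_nonneg_left h3 (sq_nonneg _)
  have h := norm_expOp_interpolation (bddReal_log_truncWeight n) (dOp ∘L R ∘L dOp) h0 h1
    (τ := 2 * θ) (by linarith) (by linarith)
  rw [rpow_interp_eq hM] at h
  have h2 := ContinuousLinearMap.le_of_opNorm_le _ h φ
  push_cast at h2 ⊢
  exact h2

/-! ### Passage to the frequency side. -/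

theorem continuous_tanh : Continuous Real.tanh :=
  continuous_iff_continuousAt.2 fun x => (hasDerivAt_tanh x).continuousAt

theorem measurableEmbedding_tanh : MeasurableEmbedding Real.tanh :=
  continuous_tanh.measurableEmbedding Real.tanh_injective

theorem measurable_artanh : Measurable Real.artanh := by
  unfold Real.artanh; fun_prop

theorem measurePreserving_artanh : MeasurePreserving Real.artanh hypMeasure volume := by
  refine ⟨measurable_artanh, ?_⟩
  rw [← measurePreserving_tanh.map_eq, Measure.map_map measurable_artanh continuous_tanh.measurable]
  have : Real.artanh ∘ Real.tanh = id := funext Real.artanh_tanh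
  rw [this, Measure.map_id]

/-- The `L²`-Fourier transform of `u ∘ tanh`. -/
def spec : L2Tilde →ₗᵢ[ℂ] L2R := (Lp.fourierTransformₗᵢ ℝ ℂ).toLinearIsometry.comp compTanh

theorem spec_eq (u : L2Tilde) : spec u = Lp.fourierTransformₗᵢ ℝ ℂ (compTanh u) := rfl

/-- The right inverse of `spec`. -/
def specInv : L2R →ₗᵢ[ℂ] L2Tilde :=
  (Lp.compMeasurePreservingₗᵢ ℂ Real.artanh measurePreserving_artanh).comp
    (Lp.fourierTransformₗᵢ ℝ ℂ).symm.toLinearIsometry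

theorem spec_specInv (v : L2R) : spec (specInv v) = v := by
  have h : compTanh (specInv v) = (Lp.fourierTransformₗᵢ ℝ ℂ).symm v := by
    refine Lp.ext ?_
    have h1 : (compTanh (specInv v) : ℝ → ℂ) =ᵐ[volume] specInv v ∘ Real.tanh :=
      Lp.coeFn_compMeasurePreserving _ measurePreserving_tanh
    have h2 : (specInv v : ℝ → ℂ) =ᵐ[hypMeasure]
        ((Lp.fourierTransformₗᵢ ℝ ℂ).symm v : L2R) ∘ Real.artanh :=
      Lp.coeFn_compMeasurePreserving _ measurePreserving_artanh
    filter_upwards [h1, measurePreserving_tanh.quasiMeasurePreserving.ae h2] with ω e1 e2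
    rw [e1, Function.comp_apply, e2, Function.comp_apply, Real.artanh_tanh]
  rw [spec_eq, h, LinearIsometryEquiv.apply_symm_apply]

theorem map_div_pi_volume :
    Measure.map (fun ξ : ℝ => ξ / Real.pi) volume = ENNReal.ofReal Real.pi • volume := by
  have : (fun ξ : ℝ => ξ / Real.pi) = fun ξ => ξ * Real.pi⁻¹ := by
    funext ξ; rw [div_eq_mul_inv]
  rw [this, Real.map_volume_mul_right (inv_ne_zero Real.pi_ne_zero), inv_inv,
    abs_of_pos Real.pi_pos]

theorem lintegral_comp_div_pi (h : ℝ → ℝ≥0∞) :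
    ∫⁻ ξ, h (ξ / Real.pi) = ENNReal.ofReal Real.pi * ∫⁻ ζ, h ζ := by
  have he : MeasurableEmbedding fun ξ : ℝ => ξ / Real.pi := by
    have := (Homeomorph.mulRight₀ (Real.pi⁻¹ : ℝ)
      (inv_ne_zero Real.pi_ne_zero)).measurableEmbedding
    simpa [div_eq_mul_inv] using this
  rw [← he.lintegral_map, map_div_pi_volume, lintegral_smul_measure, smul_eq_mul]

/-- The integral `∫ (1 + 4 ξ²) ^ s |F|²` in the variable `ζ = ξ / π`. -/
def energy (s : ℝ) (F : ℝ → ℂ) : ℝ≥0∞ :=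
  ∫⁻ ζ, ENNReal.ofReal (weight ζ ^ s) * ‖F ζ‖ₑ ^ (2 : ℝ)

theorem eLpNorm_two_eq_lintegral {μ : Measure ℝ} (f : ℝ → ℂ) :
    eLpNorm f 2 μ = (∫⁻ x, ‖f x‖ₑ ^ (2 : ℝ) ∂μ) ^ (1 / 2 : ℝ) := by
  simpa using eLpNorm_eq_lintegral_rpow_enorm_toReal (f := f) (μ := μ) (p := 2)
    (by norm_num) (by norm_num)

/-- The factor `1 / π` in the Sobolev norm cancels the Jacobian of `ξ = π ζ`, so no constant is
left. -/
theorem eLpNorm_pTransform (s : ℝ) (u : L2Tilde) :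
    eLpNorm (pTransform u) 2 (sobolevMeasure s) = energy s (spec u) ^ (1 / 2 : ℝ) := by
  have hp := Real.pi_pos
  rw [eLpNorm_two_eq_lintegral, sobolevMeasure, lintegral_withDensity_eq_lintegral_mul₀
    (by fun_prop) ((aestronglyMeasurable_pTransform u).enorm.pow_const 2)]
  congr 1
  have e : ∀ ξ : ℝ, ((fun ξ : ℝ => ENNReal.ofReal ((1 + 4 * ξ ^ 2) ^ s / Real.pi)) *
      fun ξ => ‖pTransform u ξ‖ₑ ^ (2 : ℝ)) ξ
      = (fun ζ => ENNReal.ofReal Real.pi⁻¹ *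
          (ENNReal.ofReal (weight ζ ^ s) * ‖spec u ζ‖ₑ ^ (2 : ℝ))) (ξ / Real.pi) := fun ξ => by
    have e1 : weight (ξ / Real.pi) = 1 + 4 * ξ ^ 2 := by
      unfold weight; field_simp
    simp only [Pi.mul_apply, e1]
    rw [div_eq_inv_mul _ Real.pi, ENNReal.ofReal_mul (inv_nonneg.2 hp.le), mul_assoc]
    rfl
  rw [lintegral_congr e, lintegral_comp_div_pi (fun ζ => ENNReal.ofReal Real.pi⁻¹ *
    (ENNReal.ofReal (weight ζ ^ s) * ‖spec u ζ‖ₑ ^ (2 : ℝ))),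
    lintegral_const_mul' _ _ ENNReal.ofReal_ne_top,
    ← mul_assoc, ← ENNReal.ofReal_mul hp.le, mul_inv_cancel₀ hp.ne', ENNReal.ofReal_one, one_mul,
    energy]

theorem memLp_pTransform_iff {s : ℝ} (u : L2Tilde) :
    MemLp (pTransform u) 2 (sobolevMeasure s) ↔ energy s (spec u) < ∞ := by
  rw [MemLp, eLpNorm_pTransform, ENNReal.rpow_lt_top_iff_of_pos (by norm_num)]
  exact and_iff_right ((aestronglyMeasurable_pTransform u).mono_ac (sobolevMeasure_ac s))

theorem energy_eq {s : ℝ} {F : ℝ → ℂ} {v : L2R}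
    (h : ∀ᵐ ζ, ((weight ζ ^ (s / 2) : ℝ) : ℂ) * F ζ = v ζ) :
    energy s F = ‖v‖ₑ ^ (2 : ℝ) := by
  rw [Lp.enorm_def, eLpNorm_two_eq_lintegral, ← ENNReal.rpow_mul]
  norm_num
  refine lintegral_congr_ae ?_
  filter_upwards [h] with ζ hζ
  have h0 : 0 ≤ weight ζ ^ (s / 2) := Real.rpow_nonneg (weight_pos ζ).le _
  have e : weight ζ ^ s = (weight ζ ^ (s / 2)) ^ 2 := by
    rw [← Real.rpow_natCast, ← Real.rpow_mul (weight_pos ζ).le]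
    congr 1; push_cast; ring
  rw [← hζ, enorm_mul, mul_pow, e, ENNReal.ofReal_pow h0, ← ofReal_norm ((weight ζ ^ (s / 2) : ℝ) : ℂ),
    Complex.norm_real, Real.norm_of_nonneg h0]
  norm_num

section ofMul

variable {s : ℝ} (a : ℝ → ℂ) (ha : BddMul a)
  (hs : BddMul fun ζ => ((weight ζ ^ (s / 2) : ℝ) : ℂ) * a ζ)

theorem energy_specInv_mulOp (v : L2R) :
    energy s (spec (specInv (mulOp a ha v))) = ‖mulOp _ hs v‖ₑ ^ (2 : ℝ) := by
  refine energy_eq ?_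
  rw [spec_specInv]
  filter_upwards [coeFn_mulOp ha v, coeFn_mulOp hs v] with ζ h1 h2
  rw [h1, h2, mul_assoc]

/-- The element of `H̃ˢ` with transform `a v`. -/
def ofMul : L2R →ₗ[ℂ] HTilde s where
  toFun v := HTilde.ofL2 (specInv (mulOp a ha v)) ((memLp_pTransform_iff _).2 (by
    rw [energy_specInv_mulOp a ha hs]
    exact ENNReal.rpow_lt_top_of_nonneg (by norm_num) enorm_ne_top))
  map_add' u v := HTilde.toL2_injective (by simp only [map_add, HTilde.toL2_ofL2])
  map_smul' c u := HTilde.toL2_injective (by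
    simp only [map_smul, HTilde.toL2_ofL2, RingHom.id_apply])

theorem toL2_ofMul (v : L2R) : (ofMul a ha hs v).toL2 = specInv (mulOp a ha v) := rfl

theorem spec_toL2_ofMul (v : L2R) : spec (ofMul a ha hs v).toL2 = mulOp a ha v := by
  rw [toL2_ofMul, spec_specInv]

theorem norm_ofMul (v : L2R) : ‖ofMul a ha hs v‖ = ‖mulOp _ hs v‖ := by
  rw [HTilde.norm_eq_eLpNorm, HTilde.transform, eLpNorm_pTransform, toL2_ofMul,
    energy_specInv_mulOp a ha hs, ← ENNReal.rpow_mul]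
  norm_num

theorem ofMul_eq_of_spec {v : L2R} {g : HTilde s} (h : spec g.toL2 = mulOp a ha v) :
    ofMul a ha hs v = g := by
  refine HTilde.toL2_injective (spec.injective ?_)
  rw [spec_toL2_ofMul, h]

end ofMul

/-! ### Functionals on `H̃ˢ` and the energy parametrisation of `H̃^{1/2}`. -/

/-- The Riesz representation of a continuous antilinear functional. -/
theorem exists_forall_antilinear_eq_inner {H : Type*} [NormedAddCommGroup H]
    [InnerProductSpace ℂ H] [CompleteSpace H] (f : H →ₗ⋆[ℂ] ℂ) {C : ℝ} (hC0 : 0 ≤ C)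
    (hC : ∀ v, ‖f v‖ ≤ C * ‖v‖) :
    ∃ φ : H, ‖φ‖ ≤ C ∧ ∀ v, f v = inner ℂ v φ := by
  let F : H →ₗ[ℂ] ℂ :=
    { toFun := fun v => conj (f v)
      map_add' := fun u v => by rw [map_add, map_add]
      map_smul' := fun c u => by simp }
  let L : StrongDual ℂ H := F.mkContinuous C fun v => by
    change ‖conj (f v)‖ ≤ _
    rw [RCLike.norm_conj]; exact hC v
  refine ⟨(InnerProductSpace.toDual ℂ H).symm L, ?_, fun v => ?_⟩
  · rw [LinearIsometryEquiv.norm_map]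
    exact LinearMap.mkContinuous_norm_le _ hC0 _
  · rw [← inner_conj_symm, InnerProductSpace.toDual_symm_apply]
    exact (Complex.conj_conj _).symm

theorem bddMul_weight_neg {s : ℝ} (hs : 0 ≤ s) :
    BddMul fun ζ => ((weight ζ ^ (-(s / 2)) : ℝ) : ℂ) := by
  refine BddMul.ofReal (measurable_weight.pow_const _) (C := 1) fun ζ => ?_
  rw [abs_of_nonneg (Real.rpow_nonneg (weight_pos ζ).le _)]
  exact Real.rpow_le_one_of_one_le_of_nonpos (one_le_weight ζ) (by linarith)

theorem weight_mul_weight_neg (s ζ : ℝ) :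
    ((weight ζ ^ (s / 2) : ℝ) : ℂ) * ((weight ζ ^ (-(s / 2)) : ℝ) : ℂ) = 1 := by
  rw [← Complex.ofReal_mul, ← Real.rpow_add (weight_pos ζ)]
  simp

/-- With this product equal to 1, `ofMul` for the symbol `weight ^ (-s/2)` is norm preserving from
`L²`. Functionals are pulled back along it to a Hilbert space, so the completeness of `H̃ˢ` is not
needed. -/
theorem bddMul_weight_mul_weight_neg (s : ℝ) :
    BddMul fun ζ => ((weight ζ ^ (s / 2) : ℝ) : ℂ) * ((weight ζ ^ (-(s / 2)) : ℝ) : ℂ) := by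
  simp only [weight_mul_weight_neg]
  exact ⟨measurable_const, 1, by simp⟩

/-- The representation of a functional on `H̃ˢ` by a function in `L²` on the frequency side. -/
theorem exists_dual_eq_inner {s : ℝ} (hs : 0 ≤ s) (f : HTildeDual s) :
    ∃ φ : L2R, ‖φ‖ ≤ ‖f‖ ∧ ∀ v : L2R,
      f (ofMul _ (bddMul_weight_neg hs) (bddMul_weight_mul_weight_neg s) v) = inner ℂ v φ := by
  refine exists_forall_antilinear_eq_inner
    ((f : HTilde s →ₗ⋆[ℂ] ℂ).comp
      (ofMul _ (bddMul_weight_neg hs) (bddMul_weight_mul_weight_neg s))) (norm_nonneg f) fun v => ?_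
  refine (f.le_opNorm _).trans (mul_le_mul_of_nonneg_left ?_ (norm_nonneg f))
  rw [norm_ofMul]
  have : mulOp _ (bddMul_weight_mul_weight_neg s) v = v :=
    mulOp_apply_eq _ (by simp [weight_mul_weight_neg])
  rw [this]

theorem bddMul_weight_mul_dSymbol {r : ℝ} (hr0 : 0 ≤ r) (hr : r ≤ 1 / 4) :
    BddMul fun ζ => ((weight ζ ^ r : ℝ) : ℂ) * (dSymbol ζ : ℂ) := by
  simp only [← Complex.ofReal_mul]
  refine BddMul.ofReal ((measurable_weight.pow_const _).mul measurable_dSymbol) (C := √Real.pi)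
    fun ζ => ?_
  rw [abs_of_nonneg (mul_nonneg (Real.rpow_nonneg (weight_pos ζ).le _) (dSymbol_nonneg ζ))]
  exact rpow_mul_dSymbol_le (weight_pos ζ) le_rfl hr0 hr

/-- The element of `H̃^{1/2}` with transform `m ^ (-1/2) v`. -/
def ofEnergy : L2R →ₗ[ℂ] HTilde (1 / 2) :=
  ofMul _ bddMul_dSymbol (bddMul_weight_mul_dSymbol (by norm_num) (by norm_num))

theorem spec_ofEnergy (v : L2R) : spec (ofEnergy v).toL2 = dOp v := spec_toL2_ofMul _ _ _ v

/-- The preimage of an element with transform `F` is `√m F`, square integrable because `m ≤ 2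
√weight` off the null set `{0}`. -/
theorem ofEnergy_surjective : Function.Surjective ofEnergy := by
  intro g
  set F := spec g.toL2 with hF
  have hfin : energy (1 / 2) F < ∞ := (memLp_pTransform_iff _).1 g.memLp_transform
  have hmem : MemLp (fun ζ => (√(cothSymbol ζ) : ℂ) * F ζ) 2 volume := by
    refine ⟨(Complex.measurable_ofReal.comp measurable_cothSymbol.sqrt).aestronglyMeasurable.mul
      (Lp.aestronglyMeasurable F), ?_⟩
    rw [eLpNorm_two_eq_lintegral, ENNReal.rpow_lt_top_iff_of_pos (by norm_num)]
    refine lt_of_le_of_lt ?_ (ENNReal.mul_lt_top (ENNReal.ofReal_lt_top (r := 2)) hfin)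
    rw [energy, ← lintegral_const_mul' _ _ ENNReal.ofReal_ne_top]
    refine lintegral_mono_ae ?_
    filter_upwards [(compl_mem_ae_iff.2 (measure_singleton 0) : {(0 : ℝ)}ᶜ ∈ ae volume)] with ζ hζ
    rw [enorm_mul, ENNReal.mul_rpow_of_nonneg _ _ (by norm_num), ← mul_assoc,
      ← ENNReal.ofReal_mul (by norm_num)]
    gcongr
    rw [← ofReal_norm, Complex.norm_real, Real.norm_of_nonneg (Real.sqrt_nonneg _),
      ENNReal.ofReal_rpow_of_nonneg (Real.sqrt_nonneg _) (by norm_num)]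
    refine ENNReal.ofReal_le_ofReal ?_
    rw [Real.rpow_two, Real.sq_sqrt (cothSymbol_pos hζ).le, ← Real.sqrt_eq_rpow]
    exact cothSymbol_le hζ
  refine ⟨hmem.toLp _, ofMul_eq_of_spec _ _ _ ?_⟩
  refine (mulOp_apply_eq _ ?_).symm
  filter_upwards [hmem.coeFn_toLp, (compl_mem_ae_iff.2 (measure_singleton 0) :
    {(0 : ℝ)}ᶜ ∈ ae volume)] with ζ h1 h2
  rw [h1, ← mul_assoc, ← Complex.ofReal_mul, dSymbol,
    inv_mul_cancel₀ (Real.sqrt_pos.2 (cothSymbol_pos h2)).ne', Complex.ofReal_one, one_mul]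

theorem integral_coth_eq_inner (x y : L2R) :
    1 / (Real.pi : ℂ) * ∫ ξ : ℝ,
      ((ξ * (Real.cosh (Real.pi * ξ) / Real.sinh (Real.pi * ξ)) : ℝ) : ℂ) *
        (ofEnergy x).transform ξ * conj ((ofEnergy y).transform ξ) = inner ℂ y x := by
  have hp := Real.pi_pos
  have h := Measure.integral_comp_div (fun ζ => (cothSymbol ζ : ℂ) * dOp x ζ * conj (dOp y ζ))
    Real.pi
  have e : ∀ ξ : ℝ, (cothSymbol (ξ / Real.pi) : ℂ) * dOp x (ξ / Real.pi) *
      conj (dOp y (ξ / Real.pi)) =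
      ((ξ * (Real.cosh (Real.pi * ξ) / Real.sinh (Real.pi * ξ)) : ℝ) : ℂ) *
        (ofEnergy x).transform ξ * conj ((ofEnergy y).transform ξ) := fun ξ => by
    rw [← spec_ofEnergy x, ← spec_ofEnergy y, cothSymbol, mul_div_cancel₀ _ hp.ne']
    rfl
  simp only [e] at h
  rw [h, abs_of_pos hp, Complex.real_smul, ← mul_assoc, one_div,
    inv_mul_cancel₀ (by exact_mod_cast hp.ne'), one_mul, L2.inner_def]
  refine integral_congr_ae ?_
  filter_upwards [coeFn_mulOp bddMul_dSymbol x, coeFn_mulOp bddMul_dSymbol y,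
    (compl_mem_ae_iff.2 (measure_singleton 0) : {(0 : ℝ)}ᶜ ∈ ae volume)] with ζ h1 h2 h3
  have h4 : (dSymbol ζ : ℂ) ^ 2 * (cothSymbol ζ : ℂ) = 1 := by
    exact_mod_cast dSymbol_sq_mul h3
  rw [dOp, h1, h2, RCLike.inner_apply, map_mul, Complex.conj_ofReal]
  linear_combination (x ζ * conj (y ζ)) * h4

/-- A bounded nonnegative measurable representative of `(1 - x²) V`. -/
theorem exists_bounded_representative {V : ℝ → ℝ} {M : ℝ}
    (hVmeas : AEMeasurable V (volume.restrict (Ioo (-1 : ℝ) 1)))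
    (hVnonneg : ∀ᵐ x ∂(volume.restrict (Ioo (-1 : ℝ) 1)), 0 ≤ V x)
    (hVle : ∀ᵐ x ∂(volume.restrict (Ioo (-1 : ℝ) 1)), (1 - x ^ 2) * V x ≤ M) :
    0 ≤ M ∧ ∃ W : ℝ → ℝ, Measurable W ∧ (∀ x, 0 ≤ W x ∧ W x ≤ M) ∧
      ∀ᵐ x ∂(volume.restrict (Ioo (-1 : ℝ) 1)), (1 - x ^ 2) * V x = W x := by
  have hnn : ∀ᵐ x ∂(volume.restrict (Ioo (-1 : ℝ) 1)), 0 ≤ (1 - x ^ 2) * V x := by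
    filter_upwards [hVnonneg, ae_restrict_mem measurableSet_Ioo] with x h1 h2
    exact mul_nonneg (by nlinarith [h2.1, h2.2]) h1
  -- The interval has positive measure, so some point satisfies both almost-everywhere bounds.
  have hM : 0 ≤ M := by
    have hne : (ae (volume.restrict (Ioo (-1 : ℝ) 1))).NeBot := by
      rw [ae_neBot, Ne, Measure.restrict_eq_zero]
      simp
    obtain ⟨x, h1, h2⟩ := (hnn.and hVle).exists
    exact h1.trans h2
  have hm : AEMeasurable (fun x => (1 - x ^ 2) * V x) (volume.restrict (Ioo (-1 : ℝ) 1)) :=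
    AEMeasurable.mul (by fun_prop) hVmeas
  refine ⟨hM, fun x => max 0 (min (hm.mk _ x) M), ?_, fun x => ⟨le_max_left _ _,
    max_le hM (min_le_right _ _)⟩, ?_⟩
  · exact measurable_const.max (hm.measurable_mk.min measurable_const)
  · filter_upwards [hm.ae_eq_mk, hnn, hVle] with x h1 h2 h3
    rw [← h1, min_eq_left h3, max_eq_right h2]

/-! ### The potential term and the form as an operator on `L²`. -/

section Potential

variable (W : ℝ → ℝ) (hW : BddMul fun ω => (W (Real.tanh ω) : ℂ))

/-- Multiplication by `W` on the frequency side. -/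
def potentialOp : L2R →L[ℂ] L2R :=
  ((Lp.fourierTransformₗᵢ ℝ ℂ : L2R →L[ℂ] L2R) ∘L mulOp _ hW) ∘L
    ((Lp.fourierTransformₗᵢ ℝ ℂ).symm : L2R →L[ℂ] L2R)

theorem potentialOp_apply (x : L2R) : potentialOp W hW x =
    Lp.fourierTransformₗᵢ ℝ ℂ (mulOp _ hW ((Lp.fourierTransformₗᵢ ℝ ℂ).symm x)) := rfl

theorem inner_potentialOp (x y : L2R) : inner ℂ x (potentialOp W hW y) =
    inner ℂ ((Lp.fourierTransformₗᵢ ℝ ℂ).symm x)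
      (mulOp _ hW ((Lp.fourierTransformₗᵢ ℝ ℂ).symm y)) := by
  rw [potentialOp_apply, ← (Lp.fourierTransformₗᵢ ℝ ℂ).inner_map_map (((Lp.fourierTransformₗᵢ ℝ ℂ).symm x)),
    LinearIsometryEquiv.apply_symm_apply]

theorem re_inner_mulOp {w : ℝ → ℝ} (hw : BddMul fun ω => (w ω : ℂ)) (x : L2R) :
    RCLike.re (inner ℂ x (mulOp _ hw x)) = ∫ ω, w ω * ‖x ω‖ ^ 2 := by
  rw [L2.inner_def, ← integral_re (L2.integrable_inner _ _)]
  refine integral_congr_ae ?_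
  filter_upwards [coeFn_mulOp hw x] with ω h
  rw [h, RCLike.inner_apply, mul_assoc, RCLike.mul_conj]
  simp [← Complex.ofReal_pow]

theorem norm_sq_eq_integral (x : L2R) : ‖x‖ ^ 2 = ∫ ω, ‖x ω‖ ^ 2 := by
  rw [← inner_self_eq_norm_sq (𝕜 := ℂ), L2.inner_def, ← integral_re (L2.integrable_inner _ _)]
  refine integral_congr_ae (Eventually.of_forall fun ω => ?_)
  exact inner_self_eq_norm_sq _

theorem re_inner_potentialOp_nonneg (hW0 : ∀ x, 0 ≤ W x) (x : L2R) :
    0 ≤ RCLike.re (inner ℂ x (potentialOp W hW x)) := by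
  rw [inner_potentialOp, re_inner_mulOp]
  exact integral_nonneg fun ω => mul_nonneg (hW0 _) (sq_nonneg _)

/-- By Plancherel this is the pointwise inequality `W² ≤ M W`. -/
theorem norm_potentialOp_sq_le {M : ℝ} (hWM : ∀ x, 0 ≤ W x ∧ W x ≤ M) (x : L2R) :
    ‖potentialOp W hW x‖ ^ 2 ≤ M * RCLike.re (inner ℂ x (potentialOp W hW x)) := by
  rw [inner_potentialOp, re_inner_mulOp, potentialOp_apply, LinearIsometryEquiv.norm_map,
    norm_sq_eq_integral, ← integral_const_mul]
  set y := (Lp.fourierTransformₗᵢ ℝ ℂ).symm x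
  have hint : Integrable (fun ω => W (Real.tanh ω) * ‖y ω‖ ^ 2) := by
    have h := (L2.integrable_inner (𝕜 := ℂ) y (mulOp _ hW y)).re
    refine h.congr ?_
    filter_upwards [coeFn_mulOp hW y] with ω h
    rw [h, RCLike.inner_apply, mul_assoc, RCLike.mul_conj]
    simp [← Complex.ofReal_pow]
  refine integral_mono_of_nonneg (Eventually.of_forall fun ω => sq_nonneg _)
    (hint.const_mul M) ?_
  filter_upwards [coeFn_mulOp hW y] with ω h
  obtain ⟨h0, h1⟩ := hWM (Real.tanh ω)
  rw [h, norm_mul, mul_pow, Complex.norm_real, Real.norm_of_nonneg h0, ← mul_assoc]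
  exact mul_le_mul_of_nonneg_right (by nlinarith) (sq_nonneg _)

end Potential

theorem integral_hypMeasure (h : ℝ → ℂ) :
    ∫ x, h x ∂hypMeasure =
      ∫ x in Ioo (-1 : ℝ) 1, (ENNReal.ofReal (1 / (1 - x ^ 2))).toReal • h x := by
  rw [hypMeasure, integral_withDensity_eq_integral_toReal_smul (by fun_prop)
    (Eventually.of_forall fun _ => ENNReal.ofReal_lt_top)]

theorem integral_potential_eq_inner {V W : ℝ → ℝ} (hW : BddMul fun ω => (W (Real.tanh ω) : ℂ))
    (hVW : ∀ᵐ x ∂(volume.restrict (Ioo (-1 : ℝ) 1)), (1 - x ^ 2) * V x = W x) (u g : L2Tilde) :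
    ∫ x in Ioo (-1 : ℝ) 1, (V x : ℂ) * u x * conj (g x)
      = inner ℂ (spec g) (potentialOp W hW (spec u)) := by
  have e1 : ∫ x in Ioo (-1 : ℝ) 1, (V x : ℂ) * u x * conj (g x)
      = ∫ x, (W x : ℂ) * u x * conj (g x) ∂hypMeasure := by
    rw [integral_hypMeasure]
    refine integral_congr_ae ?_
    filter_upwards [hVW, ae_restrict_mem measurableSet_Ioo] with x h1 h2
    have h3 : 0 < 1 - x ^ 2 := by nlinarith [h2.1, h2.2]
    rw [ENNReal.toReal_ofReal (by positivity), ← h1, Complex.real_smul, ← mul_assoc, ← mul_assoc,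
      ← Complex.ofReal_mul, ← mul_assoc, one_div_mul_cancel h3.ne', one_mul]
  rw [e1, ← measurePreserving_tanh.integral_comp measurableEmbedding_tanh, inner_potentialOp,
    spec_eq, spec_eq, LinearIsometryEquiv.symm_apply_apply, LinearIsometryEquiv.symm_apply_apply,
    L2.inner_def]
  refine integral_congr_ae ?_
  have hu : (compTanh u : ℝ → ℂ) =ᵐ[volume] u ∘ Real.tanh :=
    Lp.coeFn_compMeasurePreserving _ measurePreserving_tanh
  have hg : (compTanh g : ℝ → ℂ) =ᵐ[volume] g ∘ Real.tanh :=
    Lp.coeFn_compMeasurePreserving _ measurePreserving_tanh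
  filter_upwards [hu, hg, coeFn_mulOp hW (compTanh u)] with ω h1 h2 h3
  rw [h3, h1, h2, RCLike.inner_apply]
  rfl

theorem form_ofEnergy {V W : ℝ → ℝ} (hW : BddMul fun ω => (W (Real.tanh ω) : ℂ))
    (hVW : ∀ᵐ x ∂(volume.restrict (Ioo (-1 : ℝ) 1)), (1 - x ^ 2) * V x = W x) (x y : L2R) :
    form V (ofEnergy x) (ofEnergy y) = inner ℂ y (oneAddConj dOp (potentialOp W hW) x) := by
  have e : oneAddConj dOp (potentialOp W hW) x = x + dOp (potentialOp W hW (dOp x)) := rfl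
  rw [form, integral_coth_eq_inner, e, inner_add_right, ← inner_dOp, add_comm]
  congr 1
  rw [← spec_ofEnergy, ← spec_ofEnergy]
  exact integral_potential_eq_inner hW hVW _ _

/-! ### The embedding constant. -/

theorem lintegral_rpow_mul_exp_neg {a c : ℝ} (ha : 0 < a) (hc : 0 < c) :
    ∫⁻ x in Ioi (0 : ℝ), ENNReal.ofReal (x ^ (a - 1) * Real.exp (-(c * x)))
      = ENNReal.ofReal ((1 / c) ^ a * Real.Gamma a) := by
  have h := Real.integral_rpow_mul_exp_neg_mul_Ioi ha hc
  have hpos : 0 < (1 / c) ^ a * Real.Gamma a :=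
    mul_pos (Real.rpow_pos_of_pos (by positivity) _) (Real.Gamma_pos_of_pos ha)
  have hint : IntegrableOn (fun x : ℝ => x ^ (a - 1) * Real.exp (-(c * x))) (Ioi 0) := by
    -- A non-integrable function has integral 0 by convention, whereas the known value is positive.
    by_contra hn
    rw [integral_undef hn] at h
    exact hpos.ne h
  rw [← h, ofReal_integral_eq_lintegral_ofReal hint]
  filter_upwards [ae_restrict_mem measurableSet_Ioi] with x hx
  have hx : 0 < x := hx
  positivity

theorem lintegral_exp_neg_mul_sq {b : ℝ} (hb : 0 < b) :
    ∫⁻ x : ℝ, ENNReal.ofReal (Real.exp (-b * x ^ 2)) = ENNReal.ofReal √(Real.pi / b) := by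
  rw [← integral_gaussian, ofReal_integral_eq_lintegral_ofReal (integrable_exp_neg_mul_sq hb)
    (Eventually.of_forall fun x => (Real.exp_pos _).le)]

/-- Write `Γ(s) w^{-s} = ∫ x^{s-1} e^{-w x} dx` and exchange integrals by Tonelli. The Gaussian
integral in `ζ` gives `x^{-1/2} / (2√π)`, and what remains is `Γ(s - 1/2)`, finite as `s > 1/2`. -/
theorem lintegral_weight_rpow_neg {s : ℝ} (hs : 1 / 2 < s) :
    ∫⁻ ζ, ENNReal.ofReal (weight ζ ^ (-s))
      = ENNReal.ofReal (Real.Gamma (s - 1 / 2) / (2 * √Real.pi * Real.Gamma s)) := by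
  have hp := Real.pi_pos
  have hs0 : 0 < s := by linarith
  have hG : 0 < Real.Gamma s := Real.Gamma_pos_of_pos hs0
  have key : ∫⁻ ζ, ENNReal.ofReal (weight ζ ^ (-s) * Real.Gamma s)
      = ENNReal.ofReal (Real.Gamma (s - 1 / 2) / (2 * √Real.pi)) := by
    calc ∫⁻ ζ, ENNReal.ofReal (weight ζ ^ (-s) * Real.Gamma s)
        = ∫⁻ ζ : ℝ, ∫⁻ x in Ioi (0 : ℝ),
            ENNReal.ofReal (x ^ (s - 1) * Real.exp (-(weight ζ * x))) := by
          refine lintegral_congr fun ζ => ?_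
          rw [lintegral_rpow_mul_exp_neg hs0 (weight_pos ζ), one_div,
            Real.inv_rpow (weight_pos ζ).le, Real.rpow_neg (weight_pos ζ).le]
      _ = ∫⁻ x in Ioi (0 : ℝ), ∫⁻ ζ : ℝ,
            ENNReal.ofReal (x ^ (s - 1) * Real.exp (-(weight ζ * x))) := by
          refine lintegral_lintegral_swap (Measurable.aemeasurable ?_)
          have := measurable_weight
          simp only [Function.uncurry_def]
          fun_prop
      _ = ∫⁻ x in Ioi (0 : ℝ), ENNReal.ofReal (1 / (2 * √Real.pi)) *
            ENNReal.ofReal (x ^ (s - 1 / 2 - 1) * Real.exp (-(1 * x))) := by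
          refine setLIntegral_congr_fun measurableSet_Ioi fun x hx => ?_
          have hx : 0 < x := hx
          have e1 : ∀ ζ, ENNReal.ofReal (x ^ (s - 1) * Real.exp (-(weight ζ * x)))
              = ENNReal.ofReal (x ^ (s - 1) * Real.exp (-x)) *
                ENNReal.ofReal (Real.exp (-(4 * Real.pi ^ 2 * x) * ζ ^ 2)) := fun ζ => by
            rw [← ENNReal.ofReal_mul (by positivity), mul_assoc, ← Real.exp_add]
            congr 3
            unfold weight; ring
          simp only [e1]
          rw [lintegral_const_mul' _ _ ENNReal.ofReal_ne_top,
            lintegral_exp_neg_mul_sq (by positivity), ← ENNReal.ofReal_mul (by positivity),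
            ← ENNReal.ofReal_mul (by positivity)]
          congr 1
          have e2 : √(Real.pi / (4 * Real.pi ^ 2 * x)) = 1 / (2 * √Real.pi) * x ^ (-(1 / 2) : ℝ) := by
            have : Real.pi / (4 * Real.pi ^ 2 * x) = (1 / (2 * √Real.pi)) ^ 2 * x⁻¹ := by
              rw [div_pow, mul_pow, Real.sq_sqrt hp.le]
              field_simp
              norm_num
            rw [this, Real.sqrt_mul (sq_nonneg _), Real.sqrt_sq (by positivity),
              Real.rpow_neg hx.le, ← Real.sqrt_eq_rpow, Real.sqrt_inv]
          have e3 : x ^ (s - 1 / 2 - 1) = x ^ (s - 1) * x ^ (-(1 / 2) : ℝ) := by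
            rw [← Real.rpow_add hx]; congr 1; ring
          rw [e2, e3, one_mul]
          ring
      _ = _ := by
          rw [lintegral_const_mul' _ _ ENNReal.ofReal_ne_top,
            lintegral_rpow_mul_exp_neg (by linarith) one_pos, ← ENNReal.ofReal_mul (by positivity)]
          congr 1
          rw [one_div_one, Real.one_rpow]
          ring
  have e : ∀ ζ, ENNReal.ofReal (weight ζ ^ (-s)) = ENNReal.ofReal (Real.Gamma s)⁻¹ *
      ENNReal.ofReal (weight ζ ^ (-s) * Real.Gamma s) := fun ζ => by
    rw [← ENNReal.ofReal_mul (by positivity)]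
    congr 1
    field_simp
  simp only [e]
  rw [lintegral_const_mul' _ _ ENNReal.ofReal_ne_top, key, ← ENNReal.ofReal_mul (by positivity)]
  congr 1
  field_simp

/-- The weighted Cauchy–Schwarz inequality behind the embedding into continuous functions. -/
theorem lintegral_enorm_le {s : ℝ} (hs : 1 / 2 < s) (F : L2R) :
    ∫⁻ ζ, ‖F ζ‖ₑ ≤ ENNReal.ofReal (embeddingConst s) * energy s F ^ (1 / 2 : ℝ) := by
  have hw := measurable_weight
  have h := ENNReal.lintegral_mul_le_Lp_mul_Lq volume Real.HolderConjugate.two_two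
    (f := fun ζ => ENNReal.ofReal (weight ζ ^ (-(s / 2))))
    (g := fun ζ => ENNReal.ofReal (weight ζ ^ (s / 2)) * ‖F ζ‖ₑ)
    (by fun_prop) (AEMeasurable.mul (by fun_prop) (Lp.aestronglyMeasurable F).enorm)
  have e0 : ∀ ζ, ((fun ζ => ENNReal.ofReal (weight ζ ^ (-(s / 2)))) *
      fun ζ => ENNReal.ofReal (weight ζ ^ (s / 2)) * ‖F ζ‖ₑ) ζ = ‖F ζ‖ₑ := fun ζ => by
    have hwp := weight_pos ζ
    rw [Pi.mul_apply, ← mul_assoc, ← ENNReal.ofReal_mul (by positivity), ← Real.rpow_add hwp,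
      neg_add_cancel, Real.rpow_zero, ENNReal.ofReal_one, one_mul]
  have e1 : ∀ ζ, ENNReal.ofReal (weight ζ ^ (-(s / 2))) ^ (2 : ℝ)
      = ENNReal.ofReal (weight ζ ^ (-s)) := fun ζ => by
    have hwp := weight_pos ζ
    rw [ENNReal.ofReal_rpow_of_nonneg (by positivity) (by norm_num), ← Real.rpow_mul hwp.le]
    congr 2; ring
  have e2 : ∀ ζ, (ENNReal.ofReal (weight ζ ^ (s / 2)) * ‖F ζ‖ₑ) ^ (2 : ℝ)
      = ENNReal.ofReal (weight ζ ^ s) * ‖F ζ‖ₑ ^ (2 : ℝ) := fun ζ => by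
    have hwp := weight_pos ζ
    rw [ENNReal.mul_rpow_of_nonneg _ _ (by norm_num),
      ENNReal.ofReal_rpow_of_nonneg (by positivity) (by norm_num), ← Real.rpow_mul hwp.le]
    congr 3; ring
  simp only [e1, e2] at h
  rw [lintegral_congr e0, lintegral_weight_rpow_neg hs] at h
  refine h.trans_eq ?_
  have hG := Real.Gamma_pos_of_pos (show 0 < s by linarith)
  have hG2 := Real.Gamma_pos_of_pos (show 0 < s - 1 / 2 by linarith)
  rw [ENNReal.ofReal_rpow_of_nonneg (by positivity) (by norm_num), ← Real.sqrt_eq_rpow]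
  rfl

theorem integrable_of_energy_lt_top {s : ℝ} (hs : 1 / 2 < s) {F : L2R} (hF : energy s F < ∞) :
    Integrable F volume :=
  ⟨Lp.aestronglyMeasurable F, (lintegral_enorm_le hs F).trans_lt
    (ENNReal.mul_lt_top ENNReal.ofReal_lt_top (ENNReal.rpow_lt_top_of_nonneg (by norm_num) hF.ne))⟩

/-! ### Fourier inversion and continuous representatives. -/

theorem continuous_fourierInv {F : ℝ → ℂ} (hF : Integrable F volume) : Continuous (𝓕⁻ F) := by
  have hcont : Continuous (𝓕 F) :=
    VectorFourier.fourierIntegral_continuous Real.continuous_fourierChar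
      (by exact continuous_inner) hF
  have e : 𝓕⁻ F = fun x => 𝓕 F (-x) := funext fun x => Real.fourierInv_eq_fourier_neg F x
  rw [e]
  exact hcont.comp continuous_neg

theorem tendsto_fourierInv_cocompact (F : ℝ → ℂ) : Tendsto (𝓕⁻ F) (cocompact ℝ) (𝓝 0) := by
  have e : 𝓕⁻ F = fun x => 𝓕 F (-x) := funext fun x => Real.fourierInv_eq_fourier_neg F x
  rw [e]
  exact (Real.zero_at_infty_fourier F).comp (Homeomorph.neg ℝ).isClosedEmbedding.tendsto_cocompact

theorem norm_fourierInv_le (F : ℝ → ℂ) (x : ℝ) : ‖𝓕⁻ F x‖ ≤ ∫ ζ, ‖F ζ‖ := by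
  rw [Real.fourierInv_eq_fourier_neg]
  exact VectorFourier.norm_fourierIntegral_le_integral_norm _ _ _ _ _

/-- On integrable functions the inverse `L²`-Fourier transform is given by the integral. -/
theorem fourierInv_Lp_ae_eq (g : L2R) (hg : Integrable g volume) :
    (𝓕⁻ g : L2R) =ᵐ[volume] 𝓕⁻ (g : ℝ → ℂ) := by
  refine ae_eq_of_integral_contDiff_smul_eq
    ((Lp.memLp (𝓕⁻ g : L2R)).locallyIntegrable (by norm_num))
    (continuous_fourierInv hg).locallyIntegrable fun φ hφ hφc => ?_
  have hψ : ContDiff ℝ (⊤ : ℕ∞) (fun x => (φ x : ℂ)) := Complex.ofRealCLM.contDiff.comp hφ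
  have hψc : HasCompactSupport (fun x => (φ x : ℂ)) :=
    hφc.comp_left (g := fun x : ℝ => (x : ℂ)) Complex.ofReal_zero
  set ψ : SchwartzMap ℝ ℂ := hψc.toSchwartzMap hψ
  have hψa : ∀ x, ψ x = (φ x : ℂ) := fun x => rfl
  have h1 : (∫ x, ψ x • (𝓕⁻ g : L2R) x) = ∫ x, (𝓕⁻ ψ) x • g x := by
    rw [← Lp.toTemperedDistribution_apply, ← Lp.fourierInv_toTemperedDistribution_eq,
      TemperedDistribution.fourierInv_apply, Lp.toTemperedDistribution_apply]
  -- The inverse transform is the reflected transform, so the multiplication formula is applied to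
  -- the reflection of `g`.
  have h2 : (∫ x, (𝓕 (ψ : ℝ → ℂ)) (-x) • g x) = ∫ x, ψ x • 𝓕 (g : ℝ → ℂ) (-x) := by
    have h := VectorFourier.integral_fourierIntegral_smul_eq_flip (L := innerₗ ℝ)
      (μ := (volume : Measure ℝ)) (ν := (volume : Measure ℝ)) (f := ψ) (g := fun x => g (-x))
      Real.continuous_fourierChar (by exact continuous_inner) ψ.integrable hg.comp_neg
    rw [flip_innerₗ] at h
    have h3 : (∫ x, (𝓕 (ψ : ℝ → ℂ)) x • g (-x)) = ∫ x, ψ x • 𝓕 (fun x => g (-x)) x := h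
    rw [← integral_neg_eq_self] at h3
    simp only [neg_neg] at h3
    rw [h3]
    refine integral_congr_ae (Eventually.of_forall fun x => ?_)
    simp only
    congr 1
    rw [Real.fourier_eq', Real.fourier_eq', ← integral_neg_eq_self]
    simp
  simp only [← Real.fourierInv_eq_fourier_neg] at h2
  rw [← SchwartzMap.fourierInv_coe] at h2
  have h3 := h1.trans h2
  simpa [hψa] using h3

/-- The extension by zero of `W ∘ artanh` is continuous when `W` vanishes at infinity. -/
theorem continuous_indicator_comp_artanh {W : ℝ → ℂ} (hW : Continuous W)
    (h0 : Tendsto W (cocompact ℝ) (𝓝 0)) :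
    Continuous ((Ioo (-1 : ℝ) 1).indicator fun x => W (Real.artanh x)) := by
  rw [continuous_iff_continuousAt]
  intro x
  by_cases hx : x ∈ Ioo (-1 : ℝ) 1
  · have h1 : ContinuousAt Real.artanh x := by
      have ha : 0 < 1 + x := by linarith [hx.1]
      have hb : 0 < 1 - x := by linarith [hx.2]
      unfold Real.artanh
      refine ContinuousAt.log (ContinuousAt.sqrt ?_) (Real.sqrt_pos.2 (div_pos ha hb)).ne'
      exact ContinuousAt.div (by fun_prop) (by fun_prop) hb.ne'
    refine (hW.continuousAt.comp h1).congr ?_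
    filter_upwards [isOpen_Ioo.mem_nhds hx] with y hy
    rw [indicator_of_mem hy, Function.comp_apply]
  · rw [ContinuousAt, indicator_of_notMem hx, Metric.tendsto_nhds]
    intro ε hε
    have hev := Metric.tendsto_nhds.1 h0 ε hε
    obtain ⟨K, hK, hKs⟩ := mem_cocompact.1 hev
    -- The image of `K` is a compact subset of the open interval; near `x` but off this image,
    -- `artanh` takes values outside `K`, where `W` is smaller than `ε`.
    have hS : x ∉ Real.tanh '' K := by
      rintro ⟨y, -, rfl⟩
      exact hx ⟨Real.neg_one_lt_tanh y, Real.tanh_lt_one y⟩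
    filter_upwards [(hK.image continuous_tanh).isClosed.isOpen_compl.mem_nhds hS] with y hy
    by_cases hyI : y ∈ Ioo (-1 : ℝ) 1
    · rw [indicator_of_mem hyI]
      exact hKs fun hmem => hy ⟨_, hmem, Real.tanh_artanh hyI⟩
    · rw [indicator_of_notMem hyI, dist_self]
      exact hε

theorem restrict_ac_hypMeasure : volume.restrict (Ioo (-1 : ℝ) 1) ≪ hypMeasure := by
  refine withDensity_absolutelyContinuous' (Measurable.aemeasurable (by fun_prop)) ?_
  filter_upwards [ae_restrict_mem measurableSet_Ioo] with x hx
  rw [ne_eq, ENNReal.ofReal_eq_zero, not_le]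
  have : 0 < 1 - x ^ 2 := by nlinarith [hx.1, hx.2]
  positivity

theorem ae_hypMeasure_iff {p : ℝ → Prop} :
    (∀ᵐ x ∂hypMeasure, p x) ↔ ∀ᵐ ω, p (Real.tanh ω) := by
  rw [← measurePreserving_tanh.map_eq, measurableEmbedding_tanh.ae_map_iff]

/-- Functions with integrable transform are continuous on `[-1, 1]` and vanish at `±1`. -/
theorem exists_continuous_representative (u : L2Tilde) (hu : Integrable (spec u) volume) :
    ∃ v : ℝ → ℂ, v =ᵐ[volume.restrict (Ioo (-1 : ℝ) 1)] u ∧ Continuous v ∧ v (-1) = 0 ∧ v 1 = 0 ∧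
      ∀ x, ‖v x‖ ≤ ∫ ζ, ‖spec u ζ‖ := by
  refine ⟨(Ioo (-1 : ℝ) 1).indicator fun x => 𝓕⁻ (spec u : ℝ → ℂ) (Real.artanh x), ?_,
    continuous_indicator_comp_artanh (continuous_fourierInv hu) (tendsto_fourierInv_cocompact _),
    by simp, by simp, fun x => ?_⟩
  · refine restrict_ac_hypMeasure.ae_eq ?_
    rw [EventuallyEq, ae_hypMeasure_iff]
    have h1 : (compTanh u : ℝ → ℂ) =ᵐ[volume] u ∘ Real.tanh :=
      Lp.coeFn_compMeasurePreserving _ measurePreserving_tanh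
    have h2 : (𝓕⁻ (spec u) : L2R) = compTanh u := FourierTransform.fourierInv_fourier_eq _
    have h3 := fourierInv_Lp_ae_eq _ hu
    rw [h2] at h3
    filter_upwards [h1, h3] with ω e1 e3
    have hmem : Real.tanh ω ∈ Ioo (-1 : ℝ) 1 := ⟨Real.neg_one_lt_tanh ω, Real.tanh_lt_one ω⟩
    rw [indicator_of_mem hmem, Real.artanh_tanh, ← e3, e1]
    rfl
  · rw [norm_indicator_eq_indicator_norm]
    refine indicator_le' (fun x _ => norm_fourierInv_le _ _) (fun x _ => ?_) x
    exact integral_nonneg fun _ => norm_nonneg _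

/-! ### Removal of the truncation. -/

/-- Monotone convergence in `n`; finiteness of the full energy is part of the conclusion. -/
theorem energy_le_of_norm_truncPow_le {s C : ℝ} (hs : 0 ≤ s) {F : L2R}
    (h : ∀ n, ‖truncPow n (s / 2 : ℝ) F‖ ≤ C) : energy s F ≤ ENNReal.ofReal C ^ (2 : ℝ) := by
  have hb : ∀ n, ∫⁻ ζ, ENNReal.ofReal (truncWeight n ζ ^ s) * ‖F ζ‖ₑ ^ (2 : ℝ)
      ≤ ENNReal.ofReal C ^ (2 : ℝ) := fun n => by
    have e : ∫⁻ ζ, ENNReal.ofReal (truncWeight n ζ ^ s) * ‖F ζ‖ₑ ^ (2 : ℝ)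
        = ‖truncPow n (s / 2 : ℝ) F‖ₑ ^ (2 : ℝ) := by
      rw [Lp.enorm_def, eLpNorm_two_eq_lintegral, ← ENNReal.rpow_mul, one_div_mul_cancel two_ne_zero,
        ENNReal.rpow_one]
      refine lintegral_congr_ae ?_
      filter_upwards [coeFn_truncPow n (s / 2) F] with ζ hζ
      have h0 : 0 ≤ truncWeight n ζ ^ (s / 2) := Real.rpow_nonneg (truncWeight_pos n ζ).le _
      rw [hζ, enorm_mul, ENNReal.mul_rpow_of_nonneg _ _ (by norm_num),
        ← ofReal_norm ((truncWeight n ζ ^ (s / 2) : ℝ) : ℂ), Complex.norm_real,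
        Real.norm_of_nonneg h0, ENNReal.ofReal_rpow_of_nonneg h0 (by norm_num),
        ← Real.rpow_mul (truncWeight_pos n ζ).le, div_mul_cancel₀ _ two_ne_zero]
    rw [e, ← ofReal_norm]
    exact ENNReal.rpow_le_rpow (ENNReal.ofReal_le_ofReal (h n)) (by norm_num)
  refine le_of_tendsto' (lintegral_tendsto_of_tendsto_of_monotone (fun n => ?_) ?_ ?_) hb
  · exact ((measurable_truncWeight n).pow_const s).ennreal_ofReal.aemeasurable.mul
      ((Lp.aestronglyMeasurable F).enorm.pow_const 2)
  · refine Eventually.of_forall fun ζ m n hmn => ?_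
    dsimp only
    gcongr
    · exact (truncWeight_pos m ζ).le
    · exact truncWeight_mono ζ hmn
  · refine Eventually.of_forall fun ζ => ENNReal.Tendsto.mul_const ?_
      (Or.inl (ENNReal.ofReal_pos.2 (Real.rpow_pos_of_pos (weight_pos ζ) s)).ne')
    exact ENNReal.tendsto_ofReal
      ((tendsto_truncWeight ζ).rpow_const (Or.inr hs))

/-- Dominated convergence with majorant `√π |φ|`. The factor `dOp` is essential: `weight ^ r φ`
itself need not lie in `L²` when `r > 0`. -/
theorem tendsto_dOp_truncPow {r : ℝ} (hr0 : 0 ≤ r) (hr : r ≤ 1 / 4) (φ : L2R) :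
    Tendsto (fun n => dOp (truncPow n r φ)) atTop
      (𝓝 (mulOp _ (bddMul_weight_mul_dSymbol hr0 hr) φ)) := by
  set L := mulOp _ (bddMul_weight_mul_dSymbol hr0 hr) φ with hL
  have hae : ∀ n, ∀ᵐ ζ, (dOp (truncPow n r φ) - L : L2R) ζ =
      (((truncWeight n ζ ^ r - weight ζ ^ r) * dSymbol ζ : ℝ) : ℂ) * φ ζ := fun n => by
    filter_upwards [Lp.coeFn_sub (dOp (truncPow n r φ)) L,
      coeFn_mulOp bddMul_dSymbol (truncPow n r φ), coeFn_truncPow n r φ,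
      coeFn_mulOp (bddMul_weight_mul_dSymbol hr0 hr) φ] with ζ h1 h2 h3 h4
    rw [h1, Pi.sub_apply, hL, h4, dOp, h2, h3]
    push_cast
    ring
  rw [tendsto_iff_edist_tendsto_0]
  have hlim : Tendsto (fun n => ∫⁻ ζ, ‖(dOp (truncPow n r φ) - L : L2R) ζ‖ₑ ^ (2 : ℝ)) atTop
      (𝓝 (∫⁻ _ζ : ℝ, 0)) := by
    refine tendsto_lintegral_of_dominated_convergence'
      (fun ζ => ENNReal.ofReal √Real.pi ^ (2 : ℝ) * ‖φ ζ‖ₑ ^ (2 : ℝ))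
      (fun n => (Lp.aestronglyMeasurable _).enorm.pow_const 2) (fun n => ?_) ?_ ?_
    · filter_upwards [hae n] with ζ hζ
      rw [hζ, enorm_mul, ENNReal.mul_rpow_of_nonneg _ _ (by norm_num)]
      gcongr
      rw [← ofReal_norm, Complex.norm_real]
      refine ENNReal.ofReal_le_ofReal ?_
      have h0 := Real.rpow_nonneg (truncWeight_pos n ζ).le r
      have h1 : truncWeight n ζ ^ r ≤ weight ζ ^ r :=
        Real.rpow_le_rpow (truncWeight_pos n ζ).le (truncWeight_le n ζ) hr0
      have h2 := rpow_mul_dSymbol_le (weight_pos ζ) le_rfl hr0 hr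
      rw [norm_mul, Real.norm_of_nonneg (dSymbol_nonneg ζ), Real.norm_eq_abs]
      refine (mul_le_mul_of_nonneg_right ?_ (dSymbol_nonneg ζ)).trans h2
      rw [abs_le]; constructor <;> linarith
    · rw [lintegral_const_mul' _ _ (ENNReal.rpow_ne_top_of_nonneg (by norm_num)
        ENNReal.ofReal_ne_top)]
      refine ENNReal.mul_ne_top (ENNReal.rpow_ne_top_of_nonneg (by norm_num)
        ENNReal.ofReal_ne_top) ?_
      have := Lp.eLpNorm_ne_top φ
      rw [eLpNorm_two_eq_lintegral] at this
      intro htop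
      rw [htop] at this
      exact this (ENNReal.top_rpow_of_pos (by norm_num))
    · filter_upwards [ae_all_iff.2 hae] with ζ hζ
      simp only [hζ]
      have h1 : Tendsto (fun n => (((truncWeight n ζ ^ r - weight ζ ^ r) * dSymbol ζ : ℝ) : ℂ) * φ ζ)
          atTop (𝓝 ((((weight ζ ^ r - weight ζ ^ r) * dSymbol ζ : ℝ) : ℂ) * φ ζ)) :=
        ((Complex.continuous_ofReal.tendsto _).comp
          ((((tendsto_truncWeight ζ).rpow_const (Or.inr hr0)).sub_const _).mul_const _)).mul_const _
      rw [sub_self, zero_mul, Complex.ofReal_zero, zero_mul] at h1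
      have h2 := (ENNReal.continuous_rpow_const (y := 2)).tendsto 0 |>.comp
        ((continuous_enorm.tendsto (0 : ℂ)).comp h1 |>.trans_eq (by rw [enorm_zero]))
      rw [ENNReal.zero_rpow_of_pos (by norm_num)] at h2
      exact h2
  rw [lintegral_zero] at hlim
  have h3 := ((ENNReal.continuous_rpow_const (y := 1 / 2)).tendsto 0).comp hlim
  rw [ENNReal.zero_rpow_of_pos (by norm_num)] at h3
  refine h3.congr fun n => ?_
  rw [edist_eq_enorm_sub, Lp.enorm_def, eLpNorm_two_eq_lintegral]
  rfl

/-- Rewrites energy coordinates in the coordinates that represent functionals on `H̃^σ`, via `d =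
w^{-σ/2} (w^{σ/2} d)`. -/
theorem inclusion_ofEnergy {σ : ℝ} (h0 : 0 ≤ σ) (h1 : σ ≤ 1 / 2) (hr0 : 0 ≤ σ / 2)
    (hr : σ / 2 ≤ 1 / 4) (y : L2R) :
    HTilde.inclusion h1 (ofEnergy y) =
      ofMul _ (bddMul_weight_neg h0) (bddMul_weight_mul_weight_neg σ)
        (mulOp _ (bddMul_weight_mul_dSymbol hr0 hr) y) := by
  refine (ofMul_eq_of_spec _ _ _ ?_).symm
  rw [HTilde.toL2_inclusion, spec_ofEnergy]
  refine (mulOp_mulOp_apply _ _ bddMul_dSymbol (Eventually.of_forall fun ζ => ?_) y).symm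
  rw [mul_left_comm, ← mul_assoc, weight_mul_weight_neg, one_mul]

end Prandtl

end

theorem mainTheorem8 (V : ℝ → ℝ) (M : ℝ)
    (hVmeas : AEMeasurable V (volume.restrict (Ioo (-1 : ℝ) 1)))
    (hVnonneg : ∀ᵐ x ∂(volume.restrict (Ioo (-1 : ℝ) 1)), 0 ≤ V x)
    (hVle : ∀ᵐ x ∂(volume.restrict (Ioo (-1 : ℝ) 1)), (1 - x ^ 2) * V x ≤ M)
    (θ : ℝ) (hθ₀ : 0 < θ) (hθ₁ : θ ≤ 1 / 2)
    (f : Prandtl.HTildeDual (1 / 2 - θ)) :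
    ∃ u : Prandtl.HTilde (1 / 2),
      (∀ w : Prandtl.HTilde (1 / 2),
        Prandtl.IsWeakSolution V (f.restrict (sub_le_self _ hθ₀.le)) w ↔ w = u) ∧
      ∃ v : ℝ → ℂ,
        v =ᵐ[volume.restrict (Ioo (-1 : ℝ) 1)] u.fn ∧
        ContinuousOn v (Icc (-1) 1) ∧ v (-1) = 0 ∧ v 1 = 0 ∧
        ∀ x ∈ Icc (-1 : ℝ) 1,
          ‖v x‖ ≤ Prandtl.embeddingConst (1 / 2 + θ) * Prandtl.solutionConst M θ * ‖f‖ := by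
  open Prandtl in
  obtain ⟨hM, W, hWm, hWM, hVW⟩ := exists_bounded_representative hVmeas hVnonneg hVle
  have hW : BddMul fun ω => (W (Real.tanh ω) : ℂ) :=
    BddMul.ofReal (hWm.comp continuous_tanh.measurable) (C := M) fun ω => by
      rw [abs_of_nonneg (hWM _).1]; exact (hWM _).2
  have hσ : 0 ≤ 1 / 2 - θ := by linarith
  have hr0 : 0 ≤ (1 / 2 - θ) / 2 := by linarith
  have hr : (1 / 2 - θ) / 2 ≤ 1 / 4 := by linarith
  obtain ⟨φ, hφ, hfφ⟩ := exists_dual_eq_inner hσ f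
  have hB0 := re_inner_potentialOp_nonneg W hW fun x => (hWM x).1
  obtain ⟨S, hS⟩ := isUnit_oneAddConj inner_dOp hB0
  have hSR : ∀ x, oneAddConj dOp (potentialOp W hW) ((↑S⁻¹ : L2R →L[ℂ] L2R) x) = x := fun x => by
    rw [← hS]; exact DFunLike.congr_fun S.mul_inv x
  have hRS : ∀ x, (↑S⁻¹ : L2R →L[ℂ] L2R) (oneAddConj dOp (potentialOp W hW) x) = x := fun x => by
    rw [← hS]; exact DFunLike.congr_fun S.inv_mul x
  set R : L2R →L[ℂ] L2R := ↑S⁻¹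
  set k := mulOp _ (bddMul_weight_mul_dSymbol hr0 hr) φ with hk
  -- In energy coordinates the datum becomes `k`, so the weak problem reads `(1 + D B D) x = k`.
  have hpair : ∀ y, f.restrict (sub_le_self _ hθ₀.le) (ofEnergy y) = inner ℂ y k := fun y => by
    have e : f.restrict (sub_le_self _ hθ₀.le) (ofEnergy y)
        = f (HTilde.inclusion (sub_le_self _ hθ₀.le) (ofEnergy y)) := rfl
    rw [e, inclusion_ofEnergy hσ _ hr0 hr, hfφ]
    exact inner_mulOp_left _ _ (fun ζ => by simp only [map_mul, Complex.conj_ofReal]) y φ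
  refine ⟨ofEnergy (R k), fun w => ?_, ?_⟩
  · obtain ⟨x, rfl⟩ := ofEnergy_surjective w
    constructor
    · intro h
      have h1 : oneAddConj dOp (potentialOp W hW) x = k := by
        refine ext_inner_left ℂ fun y => ?_
        rw [← form_ofEnergy hW hVW, ← hpair]
        exact h _
      rw [← h1, hRS]
    · intro h g
      obtain ⟨y, rfl⟩ := ofEnergy_surjective g
      rw [h, form_ofEnergy hW hVW, hSR, hpair]
  · have hN : 0 ≤ solutionConst M θ := by
      have := Real.pi_pos
      unfold solutionConst; positivity
    have hbound : ∀ m, ‖truncPow m ((1 / 2 + θ) / 2 : ℝ) (dOp (R k))‖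
        ≤ solutionConst M θ * ‖φ‖ := fun m => by
      -- The two truncations are decoupled: with the outer index `m` fixed the operator is bounded
      -- and the inner index `n` can tend to infinity, while for `n ≥ m` the outer weight is
      -- dominated by the one with index `n`, for which the resolvent bound holds.
      have hlim : Tendsto (fun n => ‖truncPow m ((1 / 2 + θ) / 2 : ℝ)
          (dOp (R (dOp (truncPow n ((1 / 2 - θ) / 2 : ℝ) φ))))‖) atTop
          (𝓝 ‖truncPow m ((1 / 2 + θ) / 2 : ℝ) (dOp (R k))‖) :=
        ((((truncPow m ((1 / 2 + θ) / 2 : ℝ) ∘L dOp ∘L R).continuous.tendsto _).comp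
          (tendsto_dOp_truncPow hr0 hr φ))).norm
      refine le_of_tendsto hlim ?_
      filter_upwards [eventually_ge_atTop m] with n hn
      refine (norm_truncPow_mono hn (by linarith) _).trans ?_
      have h := norm_truncPow_resolvent_le hM hB0 (norm_potentialOp_sq_le W hW hWM) hSR n hθ₀.le
        hθ₁ φ
      rwa [show (1 + 2 * θ) / 4 = (1 / 2 + θ) / 2 by ring,
        show (1 - 2 * θ) / 4 = (1 / 2 - θ) / 2 by ring] at h
    have hen := energy_le_of_norm_truncPow_le (s := 1 / 2 + θ) (by linarith) hbound
    rw [← spec_ofEnergy] at hen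
    have hs : 1 / 2 < 1 / 2 + θ := by linarith
    have hint := integrable_of_energy_lt_top hs
      (hen.trans_lt (ENNReal.rpow_lt_top_of_nonneg (by norm_num) ENNReal.ofReal_ne_top))
    obtain ⟨v, hvu, hvc, hv1, hv2, hvb⟩ := exists_continuous_representative _ hint
    refine ⟨v, hvu, hvc.continuousOn, hv1, hv2, fun x _ => (hvb x).trans ?_⟩
    have hC : 0 ≤ embeddingConst (1 / 2 + θ) := Real.sqrt_nonneg _
    rw [integral_norm_eq_lintegral_enorm hint.1]
    refine ENNReal.toReal_le_of_le_ofReal (by positivity) ((lintegral_enorm_le hs _).trans ?_)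
    rw [mul_assoc, ENNReal.ofReal_mul hC]
    refine mul_le_mul_right ?_ _
    refine (ENNReal.rpow_le_rpow hen (by norm_num)).trans ?_
    rw [← ENNReal.rpow_mul, mul_one_div_cancel two_ne_zero, ENNReal.rpow_one]
    exact ENNReal.ofReal_le_ofReal (mul_le_mul_of_nonneg_left hφ hN)
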